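/- **Theorem 3.3.** Let $k\ge 2$, let $A=\{a_1,\dots,a_k\}$ be an alphabet with $k$ letters, and let $A^*$ be the set of all finite words over $A$, with empty word $\varepsilon$. A right ideal of $A^*$ is a set $R\subseteq A^*$ with $RA^*\subseteq R$; it is finitely generated if $R=CA^*$ for some finite $C\subseteq A^*$ ($C=\varnothing$ is allowed). For right ideals $R'\subseteq R$, $R'$ is essential in $R$ if $R'$ meets every nonempty right ideal contained in $R$; $R$ is essential if it is essential in $A^*$. A homomorphism between finitely generated right ideals is a function $\varphi:R\to A^*$, with $R$ a finitely generated right ideal, such that $\varphi(xw)=\varphi(x)w$ for all $x\in R$, $w\in A^*$ (its image is again a finitely generated right ideal); it is an isomorphism if it is injective. A homomorphism $\Phi$ is an essential extension of $\varphi$ if the domain of $\varphi$ is essential in the domain of $\Phi$ and $\Phi$ agrees with $\varphi$ on the domain of $\varphi$; each $\varphi$ has a unique maximal essential extension $\max(\varphi)$. Let $\mathrm{Inv}_{k,1}$ be the monoid of all maximal essential extensions of isomorphisms between finitely generated right ideals of $A^*$, with product $\varphi\cdot\psi=\max(\varphi\circ\psi)$, where $(\varphi\circ\psi)(x)=\varphi(\psi(x))$.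 Let $G_{k,1}\subseteq\mathrm{Inv}_{k,1}$ be the Thompson–Higman group, which consists of all maximal essential extensions of isomorphisms between finitely generated essential right ideals. For words $u,v$ let $(u\mapsto v)\in\mathrm{Inv}_{k,1}$ be the maximal essential extension of the map $uw\mapsto vw$ ($w\in A^*$), and for a finite set $S\subset A^*$ let $\mathrm{id}_S\in\mathrm{Inv}_{k,1}$ be the maximal essential extension of the identity map of $SA^*$. Then the inverse monoid $\mathrm{Inv}_{k,1}$ is finitely generated (as a monoid). More precisely, $G_{k,1}$ is finitely generated as a monoid, and for every subset $T$ of $G_{k,1}$ that generates $G_{k,1}$ as a monoid, the monoid $\mathrm{Inv}_{k,1}$ is generated by $T$ together with the $k+3$ elements $$(\varepsilon\mapsto a_1),\quad (a_1\mapsto\varepsilon),\quad (a_1\mapsto a_1a_1),\quad (a_1a_1\mapsto a_1),\quad \mathrm{id}_{\{a_1a_1,\,a_1a_2,\,\dots,\,a_1a_i\}}\ \ (1\le i\le k-1).$$ -/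

import Mathlib

namespace ThompsonHigman

/-- Finite words over the alphabet `A = {a₁, …, a_k}`; the letter `a_{j+1}` is `j : Fin k`.
Concatenation is `++` and the empty word is `[]`. -/
abbrev Word (k : ℕ) : Type := List (Fin k)

/-- `R A* ⊆ R`. -/
def IsRightIdeal {k : ℕ} (R : Set (Word k)) : Prop :=
  ∀ x ∈ R, ∀ w : Word k, x ++ w ∈ R

/-- The right ideal `C A*` generated by `C`. -/
def rightIdealGen {k : ℕ} (C : Set (Word k)) : Set (Word k) :=
  {x | ∃ c ∈ C, ∃ w : Word k, x = c ++ w}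

/-- `R = C A*` for some finite set `C` (the empty right ideal is allowed). -/
def IsFGRightIdeal {k : ℕ} (R : Set (Word k)) : Prop :=
  ∃ C : Set (Word k), C.Finite ∧ R = rightIdealGen C

/-- `R'` is contained in `R` and meets every nonempty right ideal contained in `R`. -/
def IsEssentialIn {k : ℕ} (R' R : Set (Word k)) : Prop :=
  R' ⊆ R ∧ ∀ I : Set (Word k), IsRightIdeal I → I.Nonempty → I ⊆ R → (I ∩ R').Nonempty

/-- `R` meets every nonempty right ideal of `A*`. -/
def IsEssential {k : ℕ} (R : Set (Word k)) : Prop :=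
  ∀ I : Set (Word k), IsRightIdeal I → I.Nonempty → (I ∩ R).Nonempty

theorem isEssentialIn_iff {k : ℕ} {R' R : Set (Word k)} (hR : IsRightIdeal R) :
    IsEssentialIn R' R ↔ R' ⊆ R ∧ ∀ x ∈ R, ∃ w : Word k, x ++ w ∈ R' := by
  refine ⟨fun ⟨h, h'⟩ => ⟨h, fun x hx => ?_⟩, fun ⟨h, h'⟩ => ⟨h, fun I hI hne hIR => ?_⟩⟩
  · obtain ⟨y, ⟨w, rfl⟩, hy⟩ := h' {y | ∃ w, y = x ++ w}
      (by rintro _ ⟨w, rfl⟩ v; exact ⟨w ++ v, by simp⟩) ⟨x, [], by simp⟩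
      (by rintro _ ⟨w, rfl⟩; exact hR x hx w)
    exact ⟨w, hy⟩
  · obtain ⟨x, hx⟩ := hne
    obtain ⟨w, hw⟩ := h' x (hIR hx)
    exact ⟨x ++ w, hI x hx w, hw⟩

theorem isEssential_iff {k : ℕ} {R : Set (Word k)} :
    IsEssential R ↔ ∀ x : Word k, ∃ w : Word k, x ++ w ∈ R := by
  have h := isEssentialIn_iff (R' := R) (R := Set.univ) (fun _ _ _ => trivial)
  simpa [IsEssentialIn, IsEssential] using h

/-- A homomorphism between finitely generated right ideals of `A*`: a partial function on words,
whose domain is a finitely generated right ideal, with `φ (x w) = φ x w` for `x` in the domain.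
(The image is then automatically a finitely generated right ideal.) -/
@[ext]
structure RIHom (k : ℕ) where
  /-- the underlying partial function -/
  toPFun : Word k → Part (Word k)
  dom_isRightIdeal : IsRightIdeal {x | (toPFun x).Dom}
  dom_fg : IsFGRightIdeal {x | (toPFun x).Dom}
  map_append : ∀ x y : Word k, y ∈ toPFun x → ∀ w : Word k, y ++ w ∈ toPFun (x ++ w)

namespace RIHom

variable {k : ℕ}

/-- The domain right ideal. -/
def dom (f : RIHom k) : Set (Word k) := {x | (f.toPFun x).Dom}

/-- The image right ideal. -/
def im (f : RIHom k) : Set (Word k) := {y | ∃ x, y ∈ f.toPFun x}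

/-- Right ideal isomorphisms are the injective right ideal homomorphisms. -/
def IsIso (f : RIHom k) : Prop :=
  ∀ x x' y : Word k, y ∈ f.toPFun x → y ∈ f.toPFun x' → x = x'

/-- `F` is an essential extension of `f`, that is, `f` is an essential restriction of `F`. -/
def IsEssentialExtension (F f : RIHom k) : Prop :=
  IsEssentialIn f.dom F.dom ∧ ∀ x y : Word k, y ∈ f.toPFun x → y ∈ F.toPFun x

/-- `f` has no essential extension but itself. -/
def IsMaximal (f : RIHom k) : Prop :=
  ∀ F : RIHom k, IsEssentialExtension F f → F = f

theorem mem_dom {f : RIHom k} {x : Word k} : x ∈ f.dom ↔ ∃ y, y ∈ f.toPFun x :=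
  Part.dom_iff_mem

theorem mem_im {f : RIHom k} {y : Word k} : y ∈ f.im ↔ ∃ x, y ∈ f.toPFun x := Iff.rfl

theorem ext_mem {f g : RIHom k} (h : ∀ x y, y ∈ f.toPFun x ↔ y ∈ g.toPFun x) : f = g :=
  RIHom.ext (funext fun x => Part.ext (h x))

theorem isEssentialExtension_iff {F f : RIHom k} : IsEssentialExtension F f ↔
    (∀ x y, y ∈ f.toPFun x → y ∈ F.toPFun x) ∧ ∀ x ∈ F.dom, ∃ w, x ++ w ∈ f.dom := by
  rw [IsEssentialExtension, isEssentialIn_iff (R := F.dom) F.dom_isRightIdeal]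
  constructor
  · rintro ⟨⟨_, h⟩, h'⟩
    exact ⟨h', h⟩
  · rintro ⟨h', h⟩
    refine ⟨⟨fun x hx => ?_, h⟩, h'⟩
    obtain ⟨y, hy⟩ := mem_dom.1 hx
    exact mem_dom.2 ⟨y, h' x y hy⟩

/-- The graph of the maximum essential extension of `f`. -/
def MaxRel (f : RIHom k) (x y : Word k) : Prop :=
  (∀ u, ∃ v, (x ++ u) ++ v ∈ f.dom) ∧ ∀ w, x ++ w ∈ f.dom → y ++ w ∈ f.toPFun (x ++ w)

theorem MaxRel.exists_dom {f : RIHom k} {x y : Word k} (h : f.MaxRel x y) :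
    ∃ w, x ++ w ∈ f.dom := by
  obtain ⟨v, hv⟩ := h.1 []
  exact ⟨v, by simpa using hv⟩

theorem MaxRel.unique {f : RIHom k} {x y y' : Word k} (h : f.MaxRel x y)
    (h' : f.MaxRel x y') : y = y' := by
  obtain ⟨w, hw⟩ := h.exists_dom
  exact List.append_cancel_right (Part.mem_unique (h.2 w hw) (h'.2 w hw))

theorem MaxRel.append {f : RIHom k} {x y : Word k} (h : f.MaxRel x y) (w : Word k) :
    f.MaxRel (x ++ w) (y ++ w) := by
  refine ⟨fun u => ?_, fun v hv => ?_⟩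
  · simpa using h.1 (w ++ u)
  · simpa using h.2 (w ++ v) (by simpa using hv)

theorem maxRel_of_mem {f : RIHom k} {x y : Word k} (h : y ∈ f.toPFun x) : f.MaxRel x y := by
  refine ⟨fun u => ⟨[], ?_⟩, fun w _ => f.map_append x y h w⟩
  exact mem_dom.2 ⟨y ++ u, by simpa using f.map_append x y h u⟩

/-- The maximum essential extension `max f`; that it is one, and the only one, is
`isMaximal_maxExt`, `isEssentialExtension_maxExt` and `eq_maxExt` below. -/
noncomputable def maxExt (f : RIHom k) : RIHom k where
  toPFun := fun x => ⟨∃ y, f.MaxRel x y, fun h => h.choose⟩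
  dom_isRightIdeal := by
    rintro x ⟨y, hy⟩ w
    exact ⟨y ++ w, hy.append w⟩
  dom_fg := by
    obtain ⟨C, hC, hf⟩ := f.dom_fg
    refine ⟨{x | (∃ y, f.MaxRel x y) ∧ (x ∈ C ∨ ∃ c ∈ C, x <+: c)}, ?_, ?_⟩
    · refine Set.Finite.subset
        (hC.union (hC.biUnion (t := fun c => {x | x <+: c}) fun c _ => ?_)) ?_
      · refine (List.finite_toSet c.inits).subset fun x hx => ?_
        simpa using hx
      · rintro x ⟨_, h | ⟨c, hc, h⟩⟩
        · exact Or.inl h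
        · exact Or.inr (Set.mem_biUnion hc h)
    · ext x
      constructor
      · rintro ⟨y, hy⟩
        obtain ⟨w, hw⟩ := hy.exists_dom
        have hw' : x ++ w ∈ rightIdealGen C := hf ▸ hw
        obtain ⟨c, hc, v, hv⟩ := hw'
        rcases List.prefix_or_prefix_of_prefix (List.prefix_append x w)
          (hv ▸ List.prefix_append c v) with h | h
        · exact ⟨x, ⟨⟨y, hy⟩, Or.inr ⟨c, hc, h⟩⟩, [], by simp⟩
        · obtain ⟨t, rfl⟩ := h
          have hcd : c ∈ f.dom := by
            change c ∈ {x | (f.toPFun x).Dom}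
            rw [hf]
            exact ⟨c, hc, [], by simp⟩
          obtain ⟨z, hz⟩ := mem_dom.1 hcd
          exact ⟨c, ⟨⟨z, maxRel_of_mem hz⟩, Or.inl hc⟩, t, rfl⟩
      · rintro ⟨c, ⟨⟨y, hy⟩, _⟩, w, rfl⟩
        exact ⟨y ++ w, hy.append w⟩
  map_append := by
    rintro x y ⟨⟨z, hz⟩, rfl⟩ w
    have hx : ∃ y, f.MaxRel x y := ⟨z, hz⟩
    have h := hx.choose_spec.append w
    have hxw : ∃ y, f.MaxRel (x ++ w) y := ⟨_, h⟩
    exact ⟨hxw, hxw.choose_spec.unique h⟩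

theorem mem_maxExt {f : RIHom k} {x y : Word k} : y ∈ f.maxExt.toPFun x ↔ f.MaxRel x y := by
  constructor
  · rintro ⟨h, rfl⟩
    exact h.choose_spec
  · intro h
    have hx : ∃ y, f.MaxRel x y := ⟨y, h⟩
    exact ⟨hx, hx.choose_spec.unique h⟩

theorem isEssentialExtension_maxExt (f : RIHom k) : IsEssentialExtension f.maxExt f := by
  rw [isEssentialExtension_iff]
  refine ⟨fun x y h => mem_maxExt.2 (maxRel_of_mem h), fun x hx => ?_⟩
  obtain ⟨y, hy⟩ := mem_dom.1 hx
  exact (mem_maxExt.1 hy).exists_dom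

theorem maxExt_eq_of_isEssentialExtension {F f : RIHom k} (h : IsEssentialExtension F f) :
    F.maxExt = f.maxExt := by
  rw [isEssentialExtension_iff] at h
  obtain ⟨h₁, h₂⟩ := h
  have hdom : ∀ x, x ∈ f.dom → x ∈ F.dom := fun x hx => by
    obtain ⟨y, hy⟩ := mem_dom.1 hx
    exact mem_dom.2 ⟨y, h₁ x y hy⟩
  refine ext_mem fun x y => ?_
  rw [mem_maxExt, mem_maxExt]
  constructor
  · rintro ⟨ha, hb⟩
    refine ⟨fun u => ?_, fun w hw => ?_⟩
    · obtain ⟨v, hv⟩ := ha u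
      obtain ⟨t, ht⟩ := h₂ _ hv
      exact ⟨v ++ t, by simpa using ht⟩
    · obtain ⟨z, hz⟩ := mem_dom.1 hw
      rwa [Part.mem_unique (hb w (hdom _ hw)) (h₁ _ _ hz)]
  · rintro ⟨ha, hb⟩
    refine ⟨fun u => ?_, fun w hw => ?_⟩
    · obtain ⟨v, hv⟩ := ha u
      exact ⟨v, hdom _ hv⟩
    · obtain ⟨z, hz⟩ := mem_dom.1 hw
      obtain ⟨t, ht⟩ := h₂ _ hw
      have e₁ := F.map_append _ _ hz t
      have e₂ := h₁ _ _ (hb (w ++ t) (by simpa using ht))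
      rw [← List.append_assoc, ← List.append_assoc] at e₂
      rwa [List.append_cancel_right (Part.mem_unique e₂ e₁)]

theorem isMaximal_maxExt (f : RIHom k) : IsMaximal f.maxExt := by
  intro F hF
  have h₁ := maxExt_eq_of_isEssentialExtension hF
  have h₂ := maxExt_eq_of_isEssentialExtension (isEssentialExtension_maxExt f)
  have h₃ := (isEssentialExtension_iff.1 (isEssentialExtension_maxExt F)).1
  have h₄ := (isEssentialExtension_iff.1 hF).1
  rw [h₁, h₂] at h₃
  exact ext_mem fun x y => ⟨h₃ x y, h₄ x y⟩

theorem IsMaximal.maxExt_eq {f : RIHom k} (h : IsMaximal f) : f.maxExt = f :=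
  h _ (isEssentialExtension_maxExt f)

theorem eq_maxExt {F f : RIHom k} (h : IsEssentialExtension F f) (hF : IsMaximal F) :
    F = f.maxExt := by
  rw [← maxExt_eq_of_isEssentialExtension h, hF.maxExt_eq]

theorem IsIso.maxExt {f : RIHom k} (h : f.IsIso) : f.maxExt.IsIso := by
  intro x x' y hx hx'
  rw [mem_maxExt] at hx hx'
  obtain ⟨w, hw⟩ := hx.exists_dom
  obtain ⟨v, hv⟩ := hx'.1 w
  have e := f.map_append _ _ (hx.2 w hw) v
  have e' := hx'.2 (w ++ v) (by simpa using hv)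
  have := h _ _ _ (by simpa using e) e'
  exact List.append_cancel_right this

/-- The identity map of `A*`. -/
def id (k : ℕ) : RIHom k where
  toPFun := fun x => Part.some x
  dom_isRightIdeal := fun _ _ _ => trivial
  dom_fg := by
    refine ⟨{[]}, Set.finite_singleton _, ?_⟩
    ext x
    exact ⟨fun _ => ⟨[], rfl, x, rfl⟩, fun _ => trivial⟩
  map_append := by
    intro x y h w
    rw [Part.mem_some_iff] at h ⊢
    rw [h]

theorem mem_id {x y : Word k} : y ∈ (id k).toPFun x ↔ y = x := Part.mem_some_iff

/-- Composition of partial functions: `(f.comp g) x = f (g x)`. -/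
def comp (f g : RIHom k) : RIHom k where
  toPFun := fun x => (g.toPFun x).bind f.toPFun
  dom_isRightIdeal := by
    intro x hx w
    obtain ⟨z, hz⟩ := Part.dom_iff_mem.1 hx
    obtain ⟨y, hy, hz⟩ := Part.mem_bind_iff.1 hz
    exact Part.dom_iff_mem.2 ⟨z ++ w, Part.mem_bind_iff.2
      ⟨y ++ w, g.map_append _ _ hy w, f.map_append _ _ hz w⟩⟩
  dom_fg := by
    obtain ⟨P, hP, hg⟩ := g.dom_fg
    obtain ⟨Q, hQ, hf⟩ := f.dom_fg
    have hsub : ∀ x, ((g.toPFun x).bind f.toPFun).Dom ↔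
        ∃ y, y ∈ g.toPFun x ∧ y ∈ rightIdealGen Q := by
      intro x
      rw [Part.dom_iff_mem, ← hf]
      constructor
      · rintro ⟨z, hz⟩
        obtain ⟨y, hy, hz⟩ := Part.mem_bind_iff.1 hz
        exact ⟨y, hy, Part.dom_iff_mem.2 ⟨z, hz⟩⟩
      · rintro ⟨y, hy, hz⟩
        obtain ⟨z, hz⟩ := Part.dom_iff_mem.1 hz
        exact ⟨z, Part.mem_bind_iff.2 ⟨y, hy, hz⟩⟩
    refine ⟨{x | ((g.toPFun x).bind f.toPFun).Dom ∧
      (x ∈ P ∨ ∃ p ∈ P, ∃ q ∈ Q, ∃ t ∈ q.tails, x = p ++ t)}, ?_, ?_⟩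
    · refine Set.Finite.subset (hP.union (hP.biUnion (t := fun p => ⋃ q ∈ Q,
        (fun t => p ++ t) '' {t | t ∈ q.tails}) fun p _ => hQ.biUnion fun q _ =>
          (List.finite_toSet q.tails).image _)) ?_
      rintro x ⟨_, h | ⟨p, hp, q, hq, t, ht, rfl⟩⟩
      · exact Or.inl h
      · exact Or.inr (Set.mem_biUnion hp (Set.mem_biUnion hq ⟨t, ht, rfl⟩))
    · ext x
      constructor
      · intro hx
        obtain ⟨y, hy, hyQ⟩ := (hsub x).1 hx
        have hxP : x ∈ rightIdealGen P := by
          rw [← hg]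
          exact Part.dom_iff_mem.2 ⟨y, hy⟩
        obtain ⟨p, hp, w, rfl⟩ := hxP
        have hpd : p ∈ {x | (g.toPFun x).Dom} := by
          rw [hg]
          exact ⟨p, hp, [], by simp⟩
        obtain ⟨r, hr⟩ := Part.dom_iff_mem.1 hpd
        obtain rfl := Part.mem_unique hy (g.map_append _ _ hr w)
        obtain ⟨q, hq, v, hv⟩ := hyQ
        rcases List.prefix_or_prefix_of_prefix (List.prefix_append r w)
          (hv ▸ List.prefix_append q v) with h | h
        · obtain ⟨t, rfl⟩ := h
          rw [List.append_assoc] at hv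
          obtain rfl := List.append_cancel_left hv
          refine ⟨p ++ t, ⟨(hsub _).2 ⟨r ++ t, g.map_append _ _ hr t, r ++ t, hq, [], by simp⟩,
            Or.inr ⟨p, hp, r ++ t, hq, t, ?_, rfl⟩⟩, v, by simp⟩
          rw [List.mem_tails]
          exact List.suffix_append r t
        · obtain ⟨t, rfl⟩ := h
          exact ⟨p, ⟨(hsub _).2 ⟨q ++ t, hr, q, hq, t, rfl⟩, Or.inl hp⟩, w, rfl⟩
      · rintro ⟨c, ⟨hc, _⟩, w, rfl⟩
        obtain ⟨y, hy, q, hq, v, rfl⟩ := (hsub c).1 hc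
        exact (hsub _).2 ⟨_, g.map_append _ _ hy w, q, hq, v ++ w, by simp⟩
  map_append := by
    intro x z hz w
    obtain ⟨y, hy, hz⟩ := Part.mem_bind_iff.1 hz
    exact Part.mem_bind_iff.2 ⟨y ++ w, g.map_append _ _ hy w, f.map_append _ _ hz w⟩

theorem mem_comp {f g : RIHom k} {x z : Word k} :
    z ∈ (f.comp g).toPFun x ↔ ∃ y, y ∈ g.toPFun x ∧ z ∈ f.toPFun y := Part.mem_bind_iff

theorem maxExt_maxExt_comp (f g : RIHom k) : (f.maxExt.comp g).maxExt = (f.comp g).maxExt := by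
  apply maxExt_eq_of_isEssentialExtension
  rw [isEssentialExtension_iff]
  refine ⟨fun x z hz => ?_, fun x hx => ?_⟩
  · obtain ⟨y, hy, hz⟩ := mem_comp.1 hz
    exact mem_comp.2 ⟨y, hy, mem_maxExt.2 (maxRel_of_mem hz)⟩
  · obtain ⟨z, hz⟩ := mem_dom.1 hx
    obtain ⟨y, hy, hz⟩ := mem_comp.1 hz
    obtain ⟨w, hw⟩ := (mem_maxExt.1 hz).exists_dom
    obtain ⟨t, ht⟩ := mem_dom.1 hw
    exact ⟨w, mem_dom.2 ⟨t, mem_comp.2 ⟨y ++ w, g.map_append _ _ hy w, ht⟩⟩⟩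

theorem maxExt_comp_maxExt (f g : RIHom k) : (f.comp g.maxExt).maxExt = (f.comp g).maxExt := by
  apply maxExt_eq_of_isEssentialExtension
  rw [isEssentialExtension_iff]
  refine ⟨fun x z hz => ?_, fun x hx => ?_⟩
  · obtain ⟨y, hy, hz⟩ := mem_comp.1 hz
    exact mem_comp.2 ⟨y, mem_maxExt.2 (maxRel_of_mem hy), hz⟩
  · obtain ⟨z, hz⟩ := mem_dom.1 hx
    obtain ⟨y, hy, hz⟩ := mem_comp.1 hz
    have hy' := mem_maxExt.1 hy
    obtain ⟨w, hw⟩ := hy'.exists_dom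
    exact ⟨w, mem_dom.2 ⟨z ++ w, mem_comp.2 ⟨y ++ w, hy'.2 w hw, f.map_append _ _ hz w⟩⟩⟩

theorem comp_assoc (f g h : RIHom k) : (f.comp g).comp h = f.comp (g.comp h) := by
  refine ext_mem fun x z => ?_
  simp only [mem_comp]
  grind

theorem id_comp (f : RIHom k) : (id k).comp f = f := by
  refine ext_mem fun x z => ?_
  simp [mem_comp, mem_id]

theorem comp_id (f : RIHom k) : f.comp (id k) = f := by
  refine ext_mem fun x z => ?_
  simp [mem_comp, mem_id]

theorem IsIso.comp {f g : RIHom k} (hf : f.IsIso) (hg : g.IsIso) : (f.comp g).IsIso := by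
  intro x x' z hz hz'
  obtain ⟨y, hy, hz⟩ := mem_comp.1 hz
  obtain ⟨y', hy', hz'⟩ := mem_comp.1 hz'
  obtain rfl := hf _ _ _ hz hz'
  exact hg _ _ _ hy hy'

theorem isIso_id : (id k).IsIso := by
  intro x x' y h h'
  rw [mem_id] at h h'
  rw [← h, ← h']

theorem isEssential_dom_comp {f g : RIHom k} (hf : IsEssential f.dom) (hg : IsEssential g.dom) :
    IsEssential (f.comp g).dom := by
  rw [isEssential_iff] at *
  intro x
  obtain ⟨w, hw⟩ := hg x
  obtain ⟨y, hy⟩ := mem_dom.1 hw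
  obtain ⟨v, hv⟩ := hf y
  obtain ⟨z, hz⟩ := mem_dom.1 hv
  refine ⟨w ++ v, mem_dom.2 ⟨z, mem_comp.2 ⟨y ++ v, ?_, hz⟩⟩⟩
  simpa using g.map_append _ _ hy v

theorem isEssential_im_comp {f g : RIHom k} (hf : IsEssential f.im) (hg : IsEssential g.im) :
    IsEssential (f.comp g).im := by
  rw [isEssential_iff] at *
  intro z
  obtain ⟨w, hw⟩ := hf z
  obtain ⟨y, hy⟩ := mem_im.1 hw
  obtain ⟨v, hv⟩ := hg y
  obtain ⟨x, hx⟩ := mem_im.1 hv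
  refine ⟨w ++ v, mem_im.2 ⟨x, mem_comp.2 ⟨y ++ v, hx, ?_⟩⟩⟩
  simpa using f.map_append _ _ hy v

theorem isEssential_dom_id : IsEssential (id k).dom :=
  isEssential_iff.2 fun _ => ⟨[], mem_dom.2 ⟨_, mem_id.2 rfl⟩⟩

theorem isEssential_im_id : IsEssential (id k).im :=
  isEssential_iff.2 fun _ => ⟨[], mem_im.2 ⟨_, mem_id.2 rfl⟩⟩

/-- The right ideal homomorphism with table `{(u, v)}`: it maps `u w` to `v w` for all `w`. -/
def single (u v : Word k) : RIHom k where
  toPFun := fun x => ⟨u <+: x, fun _ => v ++ x.drop u.length⟩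
  dom_isRightIdeal := fun x hx w => List.IsPrefix.trans hx (List.prefix_append x w)
  dom_fg := by
    refine ⟨{u}, Set.finite_singleton _, ?_⟩
    ext x
    constructor
    · rintro ⟨w, rfl⟩
      exact ⟨u, rfl, w, rfl⟩
    · rintro ⟨_, rfl, w, rfl⟩
      exact List.prefix_append _ w
  map_append := by
    rintro x _ ⟨⟨t, rfl⟩, rfl⟩ w
    exact ⟨⟨t ++ w, by simp⟩, by simp⟩

theorem mem_single {u v x y : Word k} :
    y ∈ (single u v).toPFun x ↔ ∃ w, x = u ++ w ∧ y = v ++ w := by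
  constructor
  · rintro ⟨⟨w, rfl⟩, rfl⟩
    refine ⟨w, rfl, ?_⟩
    change v ++ (u ++ w).drop u.length = v ++ w
    rw [List.drop_left]
  · rintro ⟨w, rfl, rfl⟩
    refine ⟨⟨w, rfl⟩, ?_⟩
    change v ++ (u ++ w).drop u.length = v ++ w
    rw [List.drop_left]

theorem isIso_single (u v : Word k) : (single u v).IsIso := by
  intro x x' y h h'
  obtain ⟨w, rfl, rfl⟩ := mem_single.1 h
  obtain ⟨w', rfl, h⟩ := mem_single.1 h'
  rw [List.append_cancel_left h]

/-- The identity map restricted to the right ideal `S A*`. -/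
def idOn (S : Finset (Word k)) : RIHom k where
  toPFun := fun x => ⟨x ∈ rightIdealGen (S : Set (Word k)), fun _ => x⟩
  dom_isRightIdeal := by
    rintro _ ⟨c, hc, v, rfl⟩ w
    exact ⟨c, hc, v ++ w, by simp⟩
  dom_fg := ⟨S, S.finite_toSet, rfl⟩
  map_append := by
    rintro x _ ⟨⟨c, hc, v, rfl⟩, rfl⟩ w
    exact ⟨⟨c, hc, v ++ w, by simp⟩, rfl⟩

theorem mem_idOn {S : Finset (Word k)} {x y : Word k} :
    y ∈ (idOn S).toPFun x ↔ (∃ s ∈ S, ∃ w, x = s ++ w) ∧ y = x := by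
  constructor
  · rintro ⟨h, rfl⟩
    exact ⟨h, rfl⟩
  · rintro ⟨h, rfl⟩
    exact ⟨h, rfl⟩

theorem isIso_idOn (S : Finset (Word k)) : (idOn S).IsIso := by
  intro x x' y h h'
  rw [← (mem_idOn.1 h).2, ← (mem_idOn.1 h').2]

end RIHom

/-- The Thompson-Higman partial function monoid `M_{k,1}`: all maximally (essentially) extended
homomorphisms between finitely generated right ideals of `A*`. -/
def M (k : ℕ) : Type := {f : RIHom k // f.IsMaximal}

/-- The element `max f` of `M_{k,1}`. -/
noncomputable def toM {k : ℕ} (f : RIHom k) : M k := ⟨f.maxExt, f.isMaximal_maxExt⟩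

/-- The product is composition of partial functions followed by maximal essential extension. -/
noncomputable instance instMonoidM (k : ℕ) : Monoid (M k) where
  mul f g := toM (f.1.comp g.1)
  one := toM (RIHom.id k)
  mul_assoc f g h := by
    apply Subtype.ext
    change ((f.1.comp g.1).maxExt.comp h.1).maxExt = (f.1.comp (g.1.comp h.1).maxExt).maxExt
    rw [RIHom.maxExt_maxExt_comp, RIHom.maxExt_comp_maxExt, RIHom.comp_assoc]
  one_mul f := by
    apply Subtype.ext
    change ((RIHom.id k).maxExt.comp f.1).maxExt = f.1
    rw [RIHom.maxExt_maxExt_comp, RIHom.id_comp, f.2.maxExt_eq]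
  mul_one f := by
    apply Subtype.ext
    change (f.1.comp (RIHom.id k).maxExt).maxExt = f.1
    rw [RIHom.maxExt_comp_maxExt, RIHom.comp_id, f.2.maxExt_eq]

theorem toM_mul_toM {k : ℕ} (f g : RIHom k) : toM f * toM g = toM (f.comp g) := by
  apply Subtype.ext
  change (f.maxExt.comp g.maxExt).maxExt = (f.comp g).maxExt
  rw [RIHom.maxExt_maxExt_comp, RIHom.maxExt_comp_maxExt]

/-- The Thompson-Higman inverse monoid `Inv_{k,1}`: all maximal essential extensions of
isomorphisms between finitely generated (not necessarily essential) right ideals of `A*`. -/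
def Inv (k : ℕ) : Submonoid (M k) where
  carrier := {m | ∃ f : RIHom k, f.IsIso ∧ m = toM f}
  one_mem' := ⟨RIHom.id k, RIHom.isIso_id, rfl⟩
  mul_mem' := by
    rintro _ _ ⟨f, hf, rfl⟩ ⟨g, hg, rfl⟩
    exact ⟨f.comp g, hf.comp hg, toM_mul_toM f g⟩

/-- The element of `Inv_{k,1}` given by an isomorphism between finitely generated right ideals. -/
noncomputable def toInv {k : ℕ} (f : RIHom k) (hf : f.IsIso) : Inv k := ⟨toM f, f, hf, rfl⟩

/-- The Thompson-Higman group `G_{k,1}`, as a submonoid of `Inv_{k,1}`: all maximal extensions of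
isomorphisms between finitely generated essential right ideals of `A*`. -/
def G (k : ℕ) : Submonoid (Inv k) where
  carrier := {m | ∃ (f : RIHom k) (hf : f.IsIso),
    IsEssential f.dom ∧ IsEssential f.im ∧ m = toInv f hf}
  one_mem' := ⟨RIHom.id k, RIHom.isIso_id, RIHom.isEssential_dom_id, RIHom.isEssential_im_id, rfl⟩
  mul_mem' := by
    rintro _ _ ⟨f, hf, hf₁, hf₂, rfl⟩ ⟨g, hg, hg₁, hg₂, rfl⟩
    exact ⟨f.comp g, hf.comp hg, RIHom.isEssential_dom_comp hf₁ hg₁,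
      RIHom.isEssential_im_comp hf₂ hg₂, Subtype.ext (toM_mul_toM f g)⟩

/-- The element `(u ↦ v)` of `Inv_{k,1}`. -/
noncomputable def arrow {k : ℕ} (u v : Word k) : Inv k :=
  toInv (RIHom.single u v) (RIHom.isIso_single u v)

/-- The partial identity `id_S` in `Inv_{k,1}`. -/
noncomputable def partialId {k : ℕ} (S : Finset (Word k)) : Inv k :=
  toInv (RIHom.idOn S) (RIHom.isIso_idOn S)

/-- For a letter `a = a₁`: the elements `(ε ↦ a)`, `(a ↦ ε)`, `(a ↦ aa)`, `(aa ↦ a)`, and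
the partial identities `id_{aa₁, …, aa_i}` for `1 ≤ i ≤ k - 1`. -/
noncomputable def specialElements {k : ℕ} (a : Fin k) : Set (Inv k) :=
  {arrow [] [a], arrow [a] [], arrow [a] [a, a], arrow [a, a] [a]} ∪
    {m | ∃ i : ℕ, 1 ≤ i ∧ i < k ∧
      m = partialId ((Finset.univ.filter fun b : Fin k => b.val < i).image fun b => [a, b])}

end ThompsonHigman

/-! An element of `Inv k` is determined by a finite table of pairs whose first entries form a prefix
code; injectivity makes the second entries a prefix code too. Because elements are maximal, a caret
of pairs `(u a, v a)`, with `a` running over all letters, may be contracted to `(u, v)`, which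
shortens the table since `k ≥ 2`. The basic tools are the swaps, the elements of `G k` that exchange
the cones of two incomparable words and fix the rest; they are involutions, so multiplying by them
does not affect membership in a submonoid that contains them.

The group: if both codes of a table are maximal, each contains a full set of siblings
(`Covers.exists_letters`). Swaps rearrange the second entries until the siblings correspond letter
by letter (`Table.exists_align`), and the caret contracts. By induction the table reaches `(ε, ε)`,
so all swaps generate `G k` (`Table.mem_of_covers`). Conjugation shortens swaps, so those of words
of length at most three suffice (`swap_mem_closure_shortSwaps`).

The inverse monoid: suppose some cone avoids all entries of a table. Swaps on both sides move pairs
into that cone as diagonal pairs `(u, u)`; moving `k` of them onto siblings allows a contraction,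
while another part of the cone stays free. Fewer than `k` pairs finally remain, and they become a
partial identity on some children of `a₁` (`mem_of_table_of_isFree`). A general `m` is first
squeezed into the cone of `a₁` by the arrows `ε ↦ a₁` and `a₁ ↦ ε`, which leaves the cone of another
letter free, and is recovered by the opposite arrows (`eq_top_of_swap_mem`). -/

namespace ThompsonHigman

variable {k : ℕ}

/-! ### Graphs of elements and criteria for equality -/

/-- `m` maps the word `x` to the word `y`. -/
def Maps (m : Inv k) (x y : Word k) : Prop := y ∈ m.1.1.toPFun x

theorem maps_toInv {f : RIHom k} {hf : f.IsIso} {x y : Word k} :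
    Maps (toInv f hf) x y ↔ f.MaxRel x y := RIHom.mem_maxExt

theorem maps_toInv_of_mem {f : RIHom k} {hf : f.IsIso} {x y : Word k} (h : y ∈ f.toPFun x) :
    Maps (toInv f hf) x y := maps_toInv.2 (RIHom.maxRel_of_mem h)

theorem exists_mem_of_maps_toInv {f : RIHom k} {hf : f.IsIso} {x y : Word k}
    (h : Maps (toInv f hf) x y) : ∃ w, y ++ w ∈ f.toPFun (x ++ w) := by
  obtain ⟨w, hw⟩ := (maps_toInv.1 h).exists_dom
  exact ⟨w, (maps_toInv.1 h).2 w hw⟩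

theorem maps_iff_maxRel {m : Inv k} {x y : Word k} : Maps m x y ↔ m.1.1.MaxRel x y := by
  rw [← RIHom.mem_maxExt, m.1.2.maxExt_eq]
  rfl

namespace Maps

theorem append {m : Inv k} {x y : Word k} (h : Maps m x y) (w : Word k) :
    Maps m (x ++ w) (y ++ w) := m.1.1.map_append _ _ h w

theorem unique {m : Inv k} {x y y' : Word k} (h : Maps m x y) (h' : Maps m x y') : y = y' :=
  Part.mem_unique h h'

theorem injective {m : Inv k} {x x' y : Word k} (h : Maps m x y) (h' : Maps m x' y) :
    x = x' := by
  obtain ⟨f, hf, hm⟩ := m.2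
  have hm' : m = toInv f hf := Subtype.ext hm
  rw [hm'] at h h'
  exact hf.maxExt _ _ _ h h'

theorem mul {m n : Inv k} {x y z : Word k} (h : Maps n x y) (h' : Maps m y z) :
    Maps (m * n) x z :=
  RIHom.mem_maxExt.2 (RIHom.maxRel_of_mem (RIHom.mem_comp.2 ⟨y, h, h'⟩))

/-- The product is an essential extension of the composite, so `x` may have to be lengthened before
an intermediate value exists. -/
theorem exists_of_mul {m n : Inv k} {x z : Word k} (h : Maps (m * n) x z) :
    ∃ w y, Maps n (x ++ w) y ∧ Maps m y (z ++ w) := by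
  have h' : (m.1.1.comp n.1.1).MaxRel x z := RIHom.mem_maxExt.1 h
  obtain ⟨w, hw⟩ := h'.exists_dom
  exact ⟨w, RIHom.mem_comp.1 (h'.2 w hw)⟩

end Maps

theorem maps_one (x : Word k) : Maps 1 x x :=
  RIHom.mem_maxExt.2 (RIHom.maxRel_of_mem (RIHom.mem_id.2 rfl))

/-- This is where maximality is used to contract tables: the children of `u` generate an essential
subideal of its cone, so a maximal map that is consistent on them is already defined at `u`. -/
theorem maps_of_forall_letter {m : Inv k} (u v : Word k)
    (h : ∀ a : Fin k, Maps m (u ++ [a]) (v ++ [a])) (hk : 0 < k) : Maps m u v := by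
  rw [maps_iff_maxRel]
  have h' : ∀ w : Word k, w ≠ [] → Maps m (u ++ w) (v ++ w) := by
    rintro (_ | ⟨a, w⟩) hw
    · exact absurd rfl hw
    · simpa using (h a).append w
  have hd : ∀ w : Word k, w ≠ [] → u ++ w ∈ m.1.1.dom :=
    fun w hw => RIHom.mem_dom.2 ⟨_, h' w hw⟩
  refine ⟨fun w => ⟨[⟨0, hk⟩], ?_⟩, fun w hw => ?_⟩
  · simpa using hd (w ++ [⟨0, hk⟩]) (by simp)
  · obtain ⟨y, hy⟩ := RIHom.mem_dom.1 hw
    -- The word `w` may be empty, so the values are compared after one more letter, which is then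
    -- cancelled.
    have e := Maps.unique (m := m) (Maps.append hy [⟨0, hk⟩])
      (by simpa using h' (w ++ [⟨0, hk⟩]) (by simp) : Maps m ((u ++ w) ++ [⟨0, hk⟩])
        ((v ++ w) ++ [⟨0, hk⟩]))
    rwa [List.append_cancel_right e] at hy

/-- Applied to all extensions of `(x, y)`, the hypothesis says that `m'` agrees with `m` on an
essential part of the cone of `x`; maximality of `m'` does the rest. -/
theorem maps_of_essential {m m' : Inv k}
    (h : ∀ x y, Maps m x y → ∃ w, Maps m' (x ++ w) (y ++ w)) {x y : Word k} (hxy : Maps m x y) :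
    Maps m' x y := by
  rw [maps_iff_maxRel]
  refine ⟨fun u => ?_, fun w hw => ?_⟩
  · obtain ⟨w, hw⟩ := h _ _ (hxy.append u)
    exact ⟨w, RIHom.mem_dom.2 ⟨_, hw⟩⟩
  · obtain ⟨z, hz⟩ := RIHom.mem_dom.1 hw
    obtain ⟨v, hv⟩ := h _ _ (hxy.append w)
    have e := hv.unique (Maps.append hz v)
    rwa [List.append_cancel_right e]

theorem inv_ext {m m' : Inv k} (h : ∀ x y, Maps m x y → ∃ w, Maps m' (x ++ w) (y ++ w))
    (h' : ∀ x y, Maps m' x y → ∃ w, Maps m (x ++ w) (y ++ w)) : m = m' := by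
  apply Subtype.ext
  apply Subtype.ext
  exact RIHom.ext_mem fun x y => ⟨maps_of_essential h, maps_of_essential h'⟩

/-- Two elements agree if they agree on an essential right ideal. -/
theorem inv_ext_of_essential {m m' : Inv k}
    (h : ∀ x, ∃ w y, Maps m (x ++ w) y ∧ Maps m' (x ++ w) y) : m = m' := by
  have key : ∀ {n n' : Inv k}, (∀ x, ∃ w y, Maps n (x ++ w) y ∧ Maps n' (x ++ w) y) →
      ∀ x y, Maps n x y → ∃ w, Maps n' (x ++ w) (y ++ w) := by
    intro n n' h x y hxy
    obtain ⟨w, z, h₁, h₂⟩ := h x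
    exact ⟨w, by rwa [(hxy.append w).unique h₁]⟩
  exact inv_ext (key h) (key fun x => by
    obtain ⟨w, y, h₁, h₂⟩ := h x
    exact ⟨w, y, h₂, h₁⟩)

/-! ### Incomparable words and swaps of cones -/

/-- Two words are incomparable if neither is a prefix of the other. -/
def Incomp (p q : Word k) : Prop := ¬ p <+: q ∧ ¬ q <+: p

theorem Incomp.symm {p q : Word k} (h : Incomp p q) : Incomp q p := ⟨h.2, h.1⟩

theorem Incomp.append_right {p q : Word k} (h : Incomp p q) (w : Word k) : Incomp p (q ++ w) := by
  refine ⟨fun h' => ?_, fun h' => h.2 ((List.prefix_append q w).trans h')⟩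
  rcases List.prefix_or_prefix_of_prefix h' (List.prefix_append q w) with h' | h'
  exacts [h.1 h', h.2 h']

theorem Incomp.append_left {p q : Word k} (h : Incomp p q) (w : Word k) : Incomp (p ++ w) q :=
  (h.symm.append_right w).symm

theorem Incomp.append_ne {p q : Word k} (h : Incomp p q) (w v : Word k) : p ++ w ≠ q ++ v :=
  fun e => ((h.append_left w).append_right v).1 (e ▸ List.prefix_rfl)

theorem Incomp.ne_append {p q : Word k} (h : Incomp p q) (v : Word k) : p ≠ q ++ v := by
  simpa using h.append_ne [] v

theorem incomp_of_ne {a b : Fin k} (h : a ≠ b) (u w v : Word k) :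
    Incomp (u ++ a :: w) (u ++ b :: v) := by
  constructor <;> intro h' <;> rw [List.prefix_append_right_inj, List.cons_prefix_cons] at h'
  exacts [h h'.1, h h'.1.symm]

/-- The relation `α w ↦ β w`, `β w ↦ α w`, `x ↦ x` for `x` incomparable with `α` and `β`. -/
def SwapRel (α β x y : Word k) : Prop :=
  (∃ w, x = α ++ w ∧ y = β ++ w) ∨ (∃ w, x = β ++ w ∧ y = α ++ w) ∨
    (Incomp α x ∧ Incomp β x ∧ y = x)

theorem SwapRel.symm {α β x y : Word k} (h : SwapRel α β x y) : SwapRel α β y x := by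
  rcases h with ⟨w, rfl, rfl⟩ | ⟨w, rfl, rfl⟩ | ⟨h₁, h₂, rfl⟩
  exacts [Or.inr (Or.inl ⟨w, rfl, rfl⟩), Or.inl ⟨w, rfl, rfl⟩, Or.inr (Or.inr ⟨h₁, h₂, rfl⟩)]

theorem SwapRel.unique {α β x y z : Word k} (h : Incomp α β) (hy : SwapRel α β x y)
    (hz : SwapRel α β x z) : y = z := by
  rcases hy with ⟨w, rfl, rfl⟩ | ⟨w, rfl, rfl⟩ | ⟨h₁, h₂, rfl⟩ <;>
  rcases hz with ⟨v, e, rfl⟩ | ⟨v, e, rfl⟩ | ⟨h₃, h₄, rfl⟩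
  · rw [List.append_cancel_left e]
  · exact absurd e (h.append_ne _ _)
  · exact absurd (List.prefix_append _ _) h₃.1
  · exact absurd e (h.symm.append_ne _ _)
  · rw [List.append_cancel_left e]
  · exact absurd (List.prefix_append _ _) h₄.1
  · exact absurd e (h₁.symm.ne_append _)
  · exact absurd e (h₂.symm.ne_append _)
  · rfl

theorem SwapRel.append {α β x y : Word k} (h : SwapRel α β x y) (w : Word k) :
    SwapRel α β (x ++ w) (y ++ w) := by
  rcases h with ⟨v, rfl, rfl⟩ | ⟨v, rfl, rfl⟩ | ⟨h₁, h₂, rfl⟩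
  · exact Or.inl ⟨v ++ w, by simp, by simp⟩
  · exact Or.inr (Or.inl ⟨v ++ w, by simp, by simp⟩)
  · exact Or.inr (Or.inr ⟨h₁.append_right w, h₂.append_right w, rfl⟩)

theorem exists_swapRel (α β x : Word k) : ∃ w y, SwapRel α β (x ++ w) y := by
  by_cases h₁ : Incomp α x
  · by_cases h₂ : Incomp β x
    · exact ⟨[], x, Or.inr (Or.inr ⟨by simpa, by simpa, by simp⟩)⟩
    · rw [Incomp, not_and_or, not_not, not_not] at h₂
      rcases h₂ with ⟨w, rfl⟩ | ⟨w, rfl⟩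
      · exact ⟨[], _, Or.inr (Or.inl ⟨w, by simp, rfl⟩)⟩
      · exact ⟨w, _, Or.inr (Or.inl ⟨[], by simp, rfl⟩)⟩
  · rw [Incomp, not_and_or, not_not, not_not] at h₁
    rcases h₁ with ⟨w, rfl⟩ | ⟨w, rfl⟩
    · exact ⟨[], _, Or.inl ⟨w, by simp, rfl⟩⟩
    · exact ⟨w, _, Or.inl ⟨[], by simp, rfl⟩⟩

theorem isFGRightIdeal_of_length {R : Set (Word k)} (hR : IsRightIdeal R) (N : ℕ)
    (h : ∀ x ∈ R, ∃ c ∈ R, c.length ≤ N ∧ c <+: x) : IsFGRightIdeal R := by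
  refine ⟨{c | c ∈ R ∧ c.length ≤ N},
    (List.finite_length_le (Fin k) N).subset fun c hc => hc.2, ?_⟩
  ext x
  constructor
  · intro hx
    obtain ⟨c, hc, hN, w, rfl⟩ := h x hx
    exact ⟨c, ⟨hc, hN⟩, w, rfl⟩
  · rintro ⟨c, hc, w, rfl⟩
    exact hR c hc.1 w

/-- Words longer than both `α` and `β` can be cut to the larger of the two lengths without becoming
comparable with either. -/
theorem isFGRightIdeal_swapRel (α β : Word k) :
    IsFGRightIdeal {x : Word k | ∃ y, SwapRel α β x y} := by
  refine isFGRightIdeal_of_length (fun x ⟨y, hy⟩ w => ⟨_, hy.append w⟩)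
    (max α.length β.length) ?_
  rintro x ⟨y, ⟨w, rfl, rfl⟩ | ⟨w, rfl, rfl⟩ | ⟨h₁, h₂, rfl⟩⟩
  · exact ⟨α, ⟨β, Or.inl ⟨[], by simp, by simp⟩⟩, le_max_left _ _, List.prefix_append _ _⟩
  · exact ⟨β, ⟨α, Or.inr (Or.inl ⟨[], by simp, by simp⟩)⟩, le_max_right _ _,
      List.prefix_append _ _⟩
  · rcases le_total y.length (max α.length β.length) with hl | hl
    · exact ⟨y, ⟨y, Or.inr (Or.inr ⟨h₁, h₂, rfl⟩)⟩, hl, List.prefix_rfl⟩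
    · have key : ∀ γ : Word k, Incomp γ y → γ.length ≤ max α.length β.length →
          Incomp γ (y.take (max α.length β.length)) := by
        intro γ hγ hl'
        have ht := List.take_prefix (max α.length β.length) y
        refine ⟨fun h => hγ.1 (h.trans ht), fun h => hγ.1 ?_⟩
        rwa [← h.eq_of_length_le (by rw [List.length_take]; omega)]
      exact ⟨y.take _, ⟨_, Or.inr (Or.inr ⟨key _ h₁ (le_max_left _ _), key _ h₂ (le_max_right _ _),
        rfl⟩)⟩, by rw [List.length_take]; omega, List.take_prefix _ _⟩

/-- The right ideal isomorphism that exchanges the cones of two incomparable words. -/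
noncomputable def swapHom (α β : Word k) (h : Incomp α β) : RIHom k where
  toPFun := fun x => ⟨∃ y, SwapRel α β x y, fun h => h.choose⟩
  dom_isRightIdeal := fun _ ⟨_, hy⟩ w => ⟨_, hy.append w⟩
  dom_fg := isFGRightIdeal_swapRel α β
  map_append := by
    rintro x y ⟨hx, rfl⟩ w
    have h₁ := hx.choose_spec.append w
    have hxw : ∃ y, SwapRel α β (x ++ w) y := ⟨_, h₁⟩
    exact ⟨hxw, hxw.choose_spec.unique h h₁⟩

theorem mem_swapHom {α β x y : Word k} {h : Incomp α β} :
    y ∈ (swapHom α β h).toPFun x ↔ SwapRel α β x y := by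
  constructor
  · rintro ⟨h, rfl⟩
    exact h.choose_spec
  · intro h'
    have hx : ∃ y, SwapRel α β x y := ⟨y, h'⟩
    exact ⟨hx, hx.choose_spec.unique h h'⟩

theorem isIso_swapHom {α β : Word k} (h : Incomp α β) : (swapHom α β h).IsIso :=
  fun _ _ _ hx hx' => (mem_swapHom.1 hx).symm.unique h (mem_swapHom.1 hx').symm

/-- The element of `G_{k,1}` that exchanges the cones of two incomparable words. -/
noncomputable def swap (α β : Word k) (h : Incomp α β) : Inv k :=
  toInv (swapHom α β h) (isIso_swapHom h)

theorem swap_mem_G {α β : Word k} (h : Incomp α β) : swap α β h ∈ G k := by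
  have hd : IsEssential (swapHom α β h).dom := by
    rw [isEssential_iff]
    intro x
    obtain ⟨w, y, hy⟩ := exists_swapRel α β x
    exact ⟨w, RIHom.mem_dom.2 ⟨y, mem_swapHom.2 hy⟩⟩
  refine ⟨_, isIso_swapHom h, hd, ?_, rfl⟩
  rw [isEssential_iff] at hd ⊢
  intro x
  obtain ⟨w, hw⟩ := hd x
  obtain ⟨y, hy⟩ := RIHom.mem_dom.1 hw
  exact ⟨w, y, mem_swapHom.2 (mem_swapHom.1 hy).symm⟩

theorem SwapRel.maps {α β x y : Word k} (h : Incomp α β) (hxy : SwapRel α β x y) :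
    Maps (swap α β h) x y := maps_toInv_of_mem (mem_swapHom.2 hxy)

theorem maps_swap_left {α β : Word k} (h : Incomp α β) : Maps (swap α β h) α β :=
  SwapRel.maps h (Or.inl ⟨[], by simp, by simp⟩)

theorem maps_swap_right {α β : Word k} (h : Incomp α β) : Maps (swap α β h) β α :=
  SwapRel.maps h (Or.inr (Or.inl ⟨[], by simp, by simp⟩))

theorem maps_swap_of_incomp {α β x : Word k} (h : Incomp α β) (h₁ : Incomp α x)
    (h₂ : Incomp β x) : Maps (swap α β h) x x :=
  SwapRel.maps h (Or.inr (Or.inr ⟨h₁, h₂, rfl⟩))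

/-- `SwapRel` is symmetric, and the symmetry passes to the maximal extension by testing on
sufficiently long extensions. -/
theorem Maps.swap_symm {α β x y : Word k} {h : Incomp α β} (hxy : Maps (swap α β h) x y) :
    Maps (swap α β h) y x := by
  rw [maps_iff_maxRel]
  refine ⟨fun u => ?_, fun w hw => ?_⟩
  · obtain ⟨v, hv⟩ := exists_mem_of_maps_toInv (hxy.append u)
    exact ⟨v, RIHom.mem_dom.2 ⟨_, SwapRel.maps h (mem_swapHom.1 hv).symm⟩⟩
  · obtain ⟨z, hz⟩ := RIHom.mem_dom.1 hw
    obtain ⟨v, hv⟩ := exists_mem_of_maps_toInv (hxy.append w)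
    have e := Maps.unique (SwapRel.maps h (mem_swapHom.1 hv).symm) (Maps.append hz v)
    rwa [List.append_cancel_right e]

theorem exists_maps_swap {α β : Word k} (h : Incomp α β) (x : Word k) :
    ∃ w y, Maps (swap α β h) (x ++ w) y := by
  obtain ⟨w, y, hy⟩ := exists_swapRel α β x
  exact ⟨w, y, hy.maps h⟩

theorem swap_mul_self {α β : Word k} (h : Incomp α β) : swap α β h * swap α β h = 1 := by
  refine inv_ext_of_essential fun x => ?_
  obtain ⟨w, y, hy⟩ := exists_maps_swap h x
  exact ⟨w, _, hy.mul hy.swap_symm, maps_one _⟩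

theorem swap_comm {α β : Word k} (h : Incomp α β) : swap β α h.symm = swap α β h := by
  refine inv_ext_of_essential fun x => ?_
  obtain ⟨w, y, hy⟩ := exists_swapRel α β x
  refine ⟨w, y, SwapRel.maps h.symm ?_, hy.maps h⟩
  rcases hy with hy | hy | ⟨h₁, h₂, rfl⟩
  exacts [Or.inr (Or.inl hy), Or.inl hy, Or.inr (Or.inr ⟨h₂, h₁, rfl⟩)]

/-! ### Finite tables -/

/-- `D` is a table of `m`: the first entries form a prefix code that generates an essential right
subideal of the domain of `m`, and `m` maps the first entry of each pair to the second one. -/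
structure Table (m : Inv k) (D : Finset (Word k × Word k)) : Prop where
  maps : ∀ d ∈ D, Maps m d.1 d.2
  eq_of_prefix : ∀ d ∈ D, ∀ e ∈ D, d.1 <+: e.1 → d = e
  essential : ∀ x y, Maps m x y → ∃ d ∈ D, ∃ w v, x ++ w = d.1 ++ v

/-- The prefix-minimal members of a finite generating set of the domain form a prefix code that
still generates it. -/
theorem exists_table (m : Inv k) : ∃ D, Table m D := by
  classical
  obtain ⟨C, hC, hm⟩ := m.1.1.dom_fg
  have hdom : ∀ x, (∃ y, Maps m x y) ↔ x ∈ rightIdealGen C := fun x => by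
    rw [← hm]
    exact Part.dom_iff_mem.symm
  choose! F hF using fun x => (hdom x).2
  refine ⟨(hC.toFinset.filter fun p => ∀ c ∈ C, c <+: p → c = p).image fun p => (p, F p),
    ?_, ?_, ?_⟩
  · intro d hd
    simp only [Finset.mem_image, Finset.mem_filter, Set.Finite.mem_toFinset] at hd
    obtain ⟨p, ⟨hp, _⟩, rfl⟩ := hd
    exact hF p ⟨p, hp, [], by simp⟩
  · intro d hd e he hde
    simp only [Finset.mem_image, Finset.mem_filter, Set.Finite.mem_toFinset] at hd he
    obtain ⟨p, ⟨hp, _⟩, rfl⟩ := hd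
    obtain ⟨q, ⟨_, hq⟩, rfl⟩ := he
    obtain rfl := hq p hp hde
    rfl
  · intro x y hxy
    obtain ⟨c, hc, v, hx⟩ := (hdom x).1 ⟨y, hxy⟩
    -- A shortest prefix of `x` in `C` is prefix-minimal in `C`.
    obtain ⟨p, ⟨hpC, hpx⟩, hp⟩ := Set.exists_min_image {p | p ∈ C ∧ p <+: x} List.length
      (hC.subset fun p hp => hp.1) ⟨c, hc, v, hx.symm⟩
    obtain ⟨w, rfl⟩ := hpx
    refine ⟨(p, F p), ?_, [], w, by simp⟩
    simp only [Finset.mem_image, Finset.mem_filter, Set.Finite.mem_toFinset]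
    exact ⟨p, ⟨hpC, fun c hc hcp => hcp.eq_of_length_le
      (hp c ⟨hc, hcp.trans (List.prefix_append _ _)⟩)⟩, rfl⟩

namespace Table

variable {m m' : Inv k} {D : Finset (Word k × Word k)}

/-- Injectivity pulls a prefix relation between values back to one between arguments. -/
theorem eq_of_prefix_snd (h : Table m D) {d e : Word k × Word k} (hd : d ∈ D) (he : e ∈ D)
    (hde : d.2 <+: e.2) : d = e := by
  obtain ⟨v, hv⟩ := hde
  have h₁ := (h.maps d hd).append v
  rw [hv] at h₁
  exact h.eq_of_prefix d hd e he ⟨v, h₁.injective (h.maps e he)⟩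

theorem incomp_fst (h : Table m D) {d e : Word k × Word k} (hd : d ∈ D) (he : e ∈ D)
    (hde : d ≠ e) : Incomp d.1 e.1 :=
  ⟨fun h' => hde (h.eq_of_prefix d hd e he h'), fun h' => hde (h.eq_of_prefix e he d hd h').symm⟩

theorem incomp_snd (h : Table m D) {d e : Word k × Word k} (hd : d ∈ D) (he : e ∈ D)
    (hde : d ≠ e) : Incomp d.2 e.2 :=
  ⟨fun h' => hde (h.eq_of_prefix_snd hd he h'), fun h' => hde (h.eq_of_prefix_snd he hd h').symm⟩

theorem unique (h : Table m D) (h' : Table m' D) : m = m' := by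
  have key : ∀ {n n' : Inv k}, Table n D → Table n' D → ∀ x y, Maps n x y →
      ∃ w, Maps n' (x ++ w) (y ++ w) := by
    intro n n' h h' x y hxy
    obtain ⟨d, hd, w, v, e⟩ := h.essential x y hxy
    have h₁ := hxy.append w
    have h₂ := (h'.maps d hd).append v
    rw [e] at h₁
    exact ⟨w, by rw [h₁.unique ((h.maps d hd).append v), e]; exact h₂⟩
  exact inv_ext (key h h') (key h' h)

end Table

/-! ### Contraction and rearrangement of tables -/

/-- The pairs `(u a, v a)` for all letters `a`. -/
def caret (u v : Word k) : Finset (Word k × Word k) :=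
  Finset.univ.image fun a : Fin k => (u ++ [a], v ++ [a])

theorem card_caret (u v : Word k) : (caret u v).card = k := by
  rw [caret, Finset.card_image_of_injective _ fun a b h => by simpa using h, Finset.card_univ,
    Fintype.card_fin]

theorem mem_caret {u v : Word k} {d : Word k × Word k} :
    d ∈ caret u v ↔ ∃ a, (u ++ [a], v ++ [a]) = d := by simp [caret]

theorem Table.contract {m : Inv k} {D : Finset (Word k × Word k)} (h : Table m D) (hk : 0 < k)
    {u v : Word k} (hD : caret u v ⊆ D) : Table m (insert (u, v) (D \ caret u v)) := by
  have hc : ∀ a, (u ++ [a], v ++ [a]) ∈ D := fun a => hD (mem_caret.2 ⟨a, rfl⟩)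
  have hu : ∀ d ∈ D \ caret u v, Incomp u d.1 := by
    intro d hd
    rw [Finset.mem_sdiff, mem_caret, not_exists] at hd
    have hi : ∀ a, Incomp (u ++ [a]) d.1 := fun a => h.incomp_fst (hc a) hd.1 (hd.2 a)
    refine ⟨?_, fun h' => (hi ⟨0, hk⟩).2 (h'.trans (List.prefix_append _ _))⟩
    -- If `u` were a prefix of `d.1`, then either `d.1 = u`, a prefix of every sibling, or the next
    -- letter `b` makes the sibling `u b` a prefix of `d.1`.
    rintro ⟨_ | ⟨b, w⟩, e⟩
    · exact (hi ⟨0, hk⟩).2 ⟨[⟨0, hk⟩], by rw [← e]; simp⟩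
    · exact (hi b).1 ⟨w, by rw [← e]; simp⟩
  refine ⟨?_, ?_, ?_⟩
  · intro d hd
    rcases Finset.mem_insert.1 hd with rfl | hd
    · exact maps_of_forall_letter u v (fun a => h.maps _ (hc a)) hk
    · exact h.maps d (Finset.mem_sdiff.1 hd).1
  · intro d hd e he hde
    rcases Finset.mem_insert.1 hd with rfl | hd <;> rcases Finset.mem_insert.1 he with rfl | he
    · rfl
    · exact absurd hde (hu e he).1
    · exact absurd hde (hu d hd).2
    · exact h.eq_of_prefix d (Finset.mem_sdiff.1 hd).1 e (Finset.mem_sdiff.1 he).1 hde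
  · intro x y hxy
    obtain ⟨d, hd, w, t, e⟩ := h.essential x y hxy
    by_cases hdc : d ∈ caret u v
    · obtain ⟨a, rfl⟩ := mem_caret.1 hdc
      exact ⟨(u, v), Finset.mem_insert_self _ _, w, a :: t, by simpa using e⟩
    · exact ⟨d, Finset.mem_insert_of_mem (Finset.mem_sdiff.2 ⟨hd, hdc⟩), w, t, e⟩

theorem card_contract_lt {D : Finset (Word k × Word k)} (hk : 2 ≤ k)
    {u v : Word k} (hD : caret u v ⊆ D) : (insert (u, v) (D \ caret u v)).card < D.card := by
  have h₁ := Finset.card_insert_le (u, v) (D \ caret u v)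
  have h₂ := Finset.card_sdiff_add_card_eq_card hD
  rw [card_caret] at h₂
  omega

/-- A pair `d` of a table can be replaced by `(u, u)`, by multiplying with swaps on both sides,
if `u` is incomparable with all entries. -/
theorem Table.replace {m : Inv k} {D : Finset (Word k × Word k)} (h : Table m D)
    {d : Word k × Word k} (hd : d ∈ D) {u : Word k} (hu₁ : ∀ e ∈ D, Incomp e.1 u)
    (hu₂ : ∀ e ∈ D, Incomp e.2 u) :
    Table (swap d.2 u (hu₂ d hd) * m * swap d.1 u (hu₁ d hd)) (insert (u, u) (D.erase d)) := by
  have hs : ∀ e ∈ D, e ≠ d → Maps (swap d.1 u (hu₁ d hd)) e.1 e.1 := fun e he hed =>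
    maps_swap_of_incomp _ (h.incomp_fst hd he hed.symm) (hu₁ e he).symm
  refine ⟨?_, ?_, ?_⟩
  · intro e he
    rcases Finset.mem_insert.1 he with rfl | he
    · exact (maps_swap_right _).mul ((h.maps d hd).mul (maps_swap_left _))
    · obtain ⟨hed, he⟩ := Finset.mem_erase.1 he
      exact (hs e he hed).mul ((h.maps e he).mul
        (maps_swap_of_incomp _ (h.incomp_snd hd he hed.symm) (hu₂ e he).symm))
  · intro e he f hf hef
    rcases Finset.mem_insert.1 he with rfl | he <;> rcases Finset.mem_insert.1 hf with rfl | hf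
    · rfl
    · exact absurd hef (hu₁ f (Finset.mem_of_mem_erase hf)).2
    · exact absurd hef (hu₁ e (Finset.mem_of_mem_erase he)).1
    · exact h.eq_of_prefix e (Finset.mem_of_mem_erase he) f (Finset.mem_of_mem_erase hf) hef
  · intro x z hxz
    obtain ⟨w, y, h₁, h₂⟩ := hxz.exists_of_mul
    obtain ⟨w', y', h₃, _⟩ := h₂.exists_of_mul
    obtain ⟨e, he, w'', v, hv⟩ := h.essential _ _ h₃
    -- The right-hand swap is undone: it sends `e.1 ++ v` back to an extension of `x`, which locates
    -- that extension below an entry of the new table.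
    have h₄ := ((h₁.append w').append w'').swap_symm
    rw [hv] at h₄
    by_cases hed : e = d
    · subst hed
      exact ⟨(u, u), Finset.mem_insert_self _ _, w ++ w' ++ w'', v, by
        simpa using h₄.unique ((maps_swap_left _).append v)⟩
    · exact ⟨e, Finset.mem_insert_of_mem (Finset.mem_erase.2 ⟨hed, he⟩), w ++ w' ++ w'', v, by
        simpa using h₄.unique ((hs e he hed).append v)⟩

/-- Exchanging the second entries of two pairs of a table. -/
theorem Table.swap_snd {m : Inv k} {D : Finset (Word k × Word k)} (h : Table m D)
    {d e : Word k × Word k} (hd : d ∈ D) (he : e ∈ D) (hde : d ≠ e) :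
    Table (swap d.2 e.2 (h.incomp_snd hd he hde) * m)
      (D.image fun f => (f.1, Equiv.swap d.2 e.2 f.2)) := by
  refine ⟨?_, ?_, ?_⟩
  · intro f' hf'
    obtain ⟨f, hf, rfl⟩ := Finset.mem_image.1 hf'
    refine (h.maps f hf).mul ?_
    by_cases hfd : f = d
    · subst hfd
      rw [Equiv.swap_apply_left]
      exact maps_swap_left _
    by_cases hfe : f = e
    · subst hfe
      rw [Equiv.swap_apply_right]
      exact maps_swap_right _
    have h₁ := h.incomp_snd hd hf (Ne.symm hfd)
    have h₂ := h.incomp_snd he hf (Ne.symm hfe)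
    rw [Equiv.swap_apply_of_ne_of_ne]
    · exact maps_swap_of_incomp _ h₁ h₂
    · exact fun h' => h₁.1 (h' ▸ List.prefix_rfl)
    · exact fun h' => h₂.1 (h' ▸ List.prefix_rfl)
  · intro f' hf' g' hg' hfg
    obtain ⟨f, hf, rfl⟩ := Finset.mem_image.1 hf'
    obtain ⟨g, hg, rfl⟩ := Finset.mem_image.1 hg'
    rw [h.eq_of_prefix f hf g hg hfg]
  · intro x z hxz
    obtain ⟨w, y, h₁, _⟩ := hxz.exists_of_mul
    obtain ⟨f, hf, w', v, hv⟩ := h.essential _ _ h₁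
    exact ⟨_, Finset.mem_image_of_mem _ hf, w ++ w', v, by simpa using hv⟩

/-! ### Finitely many swaps generate all swaps -/

/-- The swaps of two words of length at most three. -/
def shortSwaps (k : ℕ) : Set (Inv k) :=
  {m | ∃ (α β : Word k) (h : Incomp α β), α.length ≤ 3 ∧ β.length ≤ 3 ∧ m = swap α β h}

theorem finite_shortSwaps (k : ℕ) : (shortSwaps k).Finite := by
  classical
  have hf := (List.finite_length_le (Fin k) 3).prod (List.finite_length_le (Fin k) 3)
  refine (hf.image fun p => if h : Incomp p.1 p.2 then swap p.1 p.2 h else 1).subset ?_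
  rintro _ ⟨α, β, h, hα, hβ, rfl⟩
  exact ⟨(α, β), ⟨hα, hβ⟩, dif_pos h⟩

theorem Maps.incomp {m : Inv k} {α β α' β' : Word k} (hα : Maps m α α') (hβ : Maps m β β')
    (h : Incomp α β) : Incomp α' β' := by
  constructor <;> rintro ⟨v, rfl⟩
  · exact h.symm.ne_append v (hβ.injective (hα.append v))
  · exact h.ne_append v (hα.injective (hβ.append v))

/-- Conjugating by an involution relabels the two exchanged cones, as for transpositions in a
symmetric group. -/
theorem swap_conj {γ δ α β α' β' : Word k} {hg : Incomp γ δ} (h : Incomp α β)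
    (hα : Maps (swap γ δ hg) α α') (hβ : Maps (swap γ δ hg) β β') :
    swap α β h = swap γ δ hg * swap α' β' (hα.incomp hβ h) * swap γ δ hg := by
  refine inv_ext_of_essential fun x => ?_
  obtain ⟨w, y, hy⟩ := exists_swapRel α β x
  rcases hy with ⟨v, e, rfl⟩ | ⟨v, e, rfl⟩ | ⟨h₁, h₂, rfl⟩
  · refine ⟨w, β ++ v, ?_, ?_⟩ <;> rw [e]
    · exact (maps_swap_left h).append v
    · exact (hα.append v).mul (((maps_swap_left _).append v).mul (hβ.swap_symm.append v))
  · exact ⟨w, α ++ v, e ▸ (maps_swap_right h).append v, e ▸ (hβ.append v).mul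
      (((maps_swap_right _).append v).mul (hα.swap_symm.append v))⟩
  · obtain ⟨t, y, hy⟩ := exists_maps_swap hg (x ++ w)
    have h₃ := h₁.append_right t
    have h₄ := h₂.append_right t
    refine ⟨w ++ t, x ++ w ++ t, ?_, ?_⟩ <;> rw [← List.append_assoc]
    · exact maps_swap_of_incomp h h₃ h₄
    · exact hy.mul ((maps_swap_of_incomp _ (hα.incomp hy h₃) (hβ.incomp hy h₄)).mul hy.swap_symm)

theorem Incomp.ne_nil_left {p q : Word k} (h : Incomp p q) : p ≠ [] := by
  rintro rfl
  exact h.1 List.nil_prefix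

/-- If `γ` and `β` share their first letter, `δ` starts with a different one; otherwise `δ` keeps
the first letter of `γ` and differs in the second. -/
theorem exists_incomp_of_length (hk : 2 ≤ k) {γ β : Word k} (hγ : 2 ≤ γ.length) (hβ : β ≠ []) :
    ∃ δ : Word k, δ.length = 2 ∧ Incomp γ δ ∧ Incomp δ β := by
  have : Nontrivial (Fin k) := Fin.nontrivial_iff_two_le.2 hk
  match γ, β with
  | c :: d :: γ, b :: β =>
    by_cases hb : b = c
    · obtain ⟨a, ha⟩ := exists_ne c
      exact ⟨[a, a], rfl, incomp_of_ne ha.symm [] _ _, incomp_of_ne (hb ▸ ha) [] _ _⟩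
    · obtain ⟨a, ha⟩ := exists_ne d
      exact ⟨[c, a], rfl, incomp_of_ne ha.symm [c] _ _, incomp_of_ne (Ne.symm hb) [] _ _⟩

/-- Induction on the total length: conjugating by the swap of the three-letter prefix of the long
word with a two-letter word shortens the long word by one and does not lengthen the other. The bound
three is one more than the length of `δ`. -/
theorem swap_mem_closure_shortSwaps (hk : 2 ≤ k) {α β : Word k} (h : Incomp α β) :
    swap α β h ∈ Submonoid.closure (shortSwaps k) := by
  induction hn : α.length + β.length using Nat.strong_induction_on generalizing α β with
  | _ n ih =>
    subst hn
    have key : ∀ {α' β' : Word k} (h' : Incomp α' β'),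
        α'.length + β'.length = α.length + β.length → 3 < α'.length →
        swap α' β' h' ∈ Submonoid.closure (shortSwaps k) := by
      intro α' β' h' hl hα
      have hγ : (α'.take 3).length = 3 := by rw [List.length_take]; omega
      obtain ⟨δ, hδ, hγδ, hδβ⟩ := exists_incomp_of_length hk (γ := α'.take 3) (β := β')
        (by omega) h'.symm.ne_nil_left
      obtain ⟨ω, hω⟩ := List.take_prefix 3 α'
      have hα' := (maps_swap_left hγδ).append ω
      rw [hω] at hα'
      have hs : swap _ _ hγδ ∈ Submonoid.closure (shortSwaps k) :=
        Submonoid.subset_closure ⟨_, _, hγδ, by omega, by omega, rfl⟩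
      have hlen : (δ ++ ω).length < α'.length := by
        have := congrArg List.length hω
        rw [List.length_append] at this ⊢
        omega
      obtain ⟨β'', hβ, hlβ⟩ : ∃ β'', Maps (swap _ _ hγδ) β' β'' ∧ β''.length ≤ β'.length := by
        -- Either `β'` lies in the moved cone and gets shorter as well, or it is incomparable with
        -- both swapped words and stays fixed.
        by_cases hc : α'.take 3 <+: β'
        · obtain ⟨t, ht⟩ := hc
          refine ⟨δ ++ t, ht ▸ (maps_swap_left hγδ).append t, ?_⟩
          rw [← ht, List.length_append, List.length_append]
          omega
        · exact ⟨β', maps_swap_of_incomp hγδ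
            ⟨hc, fun h'' => h'.2 (h''.trans (List.take_prefix _ _))⟩ hδβ, le_rfl⟩
      rw [swap_conj h' hα' hβ]
      exact mul_mem (mul_mem hs (ih _ (by omega) _ rfl)) hs
    rcases lt_or_ge 3 α.length with hα | hα
    · exact key h rfl hα
    rcases lt_or_ge 3 β.length with hβ | hβ
    · rw [← swap_comm]
      exact key h.symm (Nat.add_comm _ _) hβ
    · exact Submonoid.subset_closure ⟨α, β, h, hα, hβ, rfl⟩

/-! ### The group is generated by swaps -/

/-- Every word is comparable with an element of `P`. -/
def Covers (P : Finset (Word k)) : Prop := ∀ x, ∃ p ∈ P, ¬ Incomp p x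

theorem eq_nil_of_covers_singleton (hk : 2 ≤ k) {p : Word k} (h : Covers {p}) : p = [] := by
  have : Nontrivial (Fin k) := Fin.nontrivial_iff_two_le.2 hk
  rcases p with _ | ⟨a, p⟩
  · rfl
  · obtain ⟨b, hb⟩ := exists_ne a
    obtain ⟨q, hq, hi⟩ := h [b]
    rw [Finset.mem_singleton.1 hq] at hi
    exact absurd (incomp_of_ne hb.symm [] _ _) hi

/-- Take a longest code word `u b`. A code word comparable with a sibling `u a` cannot be longer,
and a proper prefix of `u a` would be a proper prefix of `u b`; hence it is `u a` itself. -/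
theorem Covers.exists_letters {P : Finset (Word k)} (h : Covers P)
    (hP : ∀ p ∈ P, ∀ q ∈ P, p <+: q → p = q) (hnil : [] ∉ P) :
    ∃ u : Word k, ∀ a, u ++ [a] ∈ P := by
  obtain ⟨p₀, hp₀, _⟩ := h []
  obtain ⟨p, hp, hmax⟩ := P.exists_max_image List.length ⟨p₀, hp₀⟩
  rcases List.eq_nil_or_concat p with rfl | ⟨u, b, rfl⟩
  · exact absurd hp hnil
  refine ⟨u, fun a => ?_⟩
  obtain ⟨q, hq, hi⟩ := h (u ++ [a])
  rw [Incomp, not_and_or, not_not, not_not] at hi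
  rcases hi with hi | hi
  · rcases List.prefix_concat_iff.1 hi with rfl | hi
    · exact hq
    · obtain rfl := hP q hq _ hp (hi.trans (by simp))
      simpa using hi.length_le
  · rwa [hi.eq_of_length_le (by simpa using hmax q hq)]

theorem Covers.contract {P P' : Finset (Word k)} (h : Covers P) (u : Word k) (hu : u ∈ P')
    (hP : ∀ p ∈ P, p ∈ P' ∨ ∃ a, p = u ++ [a]) : Covers P' := by
  intro x
  obtain ⟨p, hp, hi⟩ := h x
  rcases hP p hp with hp | ⟨a, rfl⟩
  · exact ⟨p, hp, hi⟩
  · exact ⟨u, hu, fun h' => hi (h'.append_left _)⟩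

theorem Covers.contract_table {D : Finset (Word k × Word k)} (u v : Word k)
    (h₁ : Covers (D.image Prod.fst)) (h₂ : Covers (D.image Prod.snd)) :
    Covers ((insert (u, v) (D \ caret u v)).image Prod.fst) ∧
      Covers ((insert (u, v) (D \ caret u v)).image Prod.snd) := by
  have key : ∀ d ∈ D, d ∈ insert (u, v) (D \ caret u v) ∨ ∃ a, (u ++ [a], v ++ [a]) = d :=
    fun d hd => by
      by_cases hc : d ∈ caret u v
      · exact Or.inr (mem_caret.1 hc)
      · exact Or.inl (Finset.mem_insert_of_mem (Finset.mem_sdiff.2 ⟨hd, hc⟩))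
  constructor
  · refine h₁.contract u (Finset.mem_image.2 ⟨(u, v), Finset.mem_insert_self _ _, rfl⟩) ?_
    intro p hp
    obtain ⟨d, hd, rfl⟩ := Finset.mem_image.1 hp
    rcases key d hd with hd | ⟨a, rfl⟩
    exacts [Or.inl (Finset.mem_image_of_mem _ hd), Or.inr ⟨a, rfl⟩]
  · refine h₂.contract v (Finset.mem_image.2 ⟨(u, v), Finset.mem_insert_self _ _, rfl⟩) ?_
    intro p hp
    obtain ⟨d, hd, rfl⟩ := Finset.mem_image.1 hp
    rcases key d hd with hd | ⟨a, rfl⟩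
    exacts [Or.inl (Finset.mem_image_of_mem _ hd), Or.inr ⟨a, rfl⟩]

theorem image_swap_eq_self {ι : Type*} [DecidableEq ι] {P : Finset ι} {x y : ι} (hx : x ∈ P)
    (hy : y ∈ P) : P.image (Equiv.swap x y) = P := by
  refine Finset.eq_of_subset_of_card_le (fun z hz => ?_)
    (Finset.card_image_of_injective _ (Equiv.swap x y).injective).ge
  obtain ⟨t, ht, rfl⟩ := Finset.mem_image.1 hz
  by_cases h₁ : t = x
  · rw [h₁, Equiv.swap_apply_left]
    exact hy
  by_cases h₂ : t = y
  · rw [h₂, Equiv.swap_apply_right]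
    exact hx
  · rwa [Equiv.swap_apply_of_ne_of_ne h₁ h₂]

/-- Left multiplication by swaps permutes the second entries, so the pairs over the siblings are
matched one letter at a time. Both codes stay the same sets, and `m` is recovered because swaps are
involutions. -/
theorem Table.exists_align {H : Submonoid (Inv k)} (hH : ∀ α β h, swap α β h ∈ H) {m : Inv k}
    {D : Finset (Word k × Word k)} (h : Table m D) {u v : Word k}
    (hu : ∀ a, u ++ [a] ∈ D.image Prod.fst) (hv : ∀ a, v ++ [a] ∈ D.image Prod.snd)
    (J : Finset (Fin k)) :
    ∃ (m' : Inv k) (D' : Finset (Word k × Word k)), (m' ∈ H → m ∈ H) ∧ Table m' D' ∧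
      D'.card = D.card ∧ D'.image Prod.fst = D.image Prod.fst ∧
      D'.image Prod.snd = D.image Prod.snd ∧ ∀ a ∈ J, (u ++ [a], v ++ [a]) ∈ D' := by
  induction J using Finset.induction_on with
  | empty => exact ⟨m, D, fun h => h, h, rfl, rfl, rfl, by simp⟩
  | insert a J ha ih =>
    obtain ⟨m', D', hm, h', hc, h₁, h₂, hJ⟩ := ih
    obtain ⟨⟨p, q⟩, hd, hp⟩ := Finset.mem_image.1 (h₁ ▸ hu a)
    obtain ⟨⟨p', q'⟩, he, hq⟩ := Finset.mem_image.1 (h₂ ▸ hv a)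
    simp only at hp hq
    subst hp hq
    by_cases hde : (u ++ [a], q) = (p', v ++ [a])
    · refine ⟨m', D', hm, h', hc, h₁, h₂, fun b hb => ?_⟩
      rcases Finset.mem_insert.1 hb with rfl | hb
      · obtain ⟨-, rfl⟩ := Prod.mk.inj hde
        exact hd
      · exact hJ b hb
    · refine ⟨_, _, fun hmem => hm ?_, h'.swap_snd hd he hde, ?_, ?_, ?_, ?_⟩
      · rw [← one_mul m', ← swap_mul_self (h'.incomp_snd hd he hde), mul_assoc]
        exact mul_mem (hH _ _ _) hmem
      · rw [← hc]
        refine Finset.card_image_of_injective _ fun x y hxy => ?_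
        obtain ⟨e₁, e₂⟩ := Prod.mk.inj hxy
        exact Prod.ext e₁ ((Equiv.swap _ _).injective e₂)
      · rw [← h₁, Finset.image_image]
        rfl
      · rw [← h₂, Finset.image_image]
        conv_rhs => rw [← image_swap_eq_self (Finset.mem_image_of_mem Prod.snd hd)
          (Finset.mem_image_of_mem Prod.snd he), Finset.image_image]
        rfl
      · intro b hb
        rcases Finset.mem_insert.1 hb with rfl | hb
        · exact Finset.mem_image.2 ⟨_, hd, by simp⟩
        · have hba : b ≠ a := fun e => ha (e ▸ hb)
          refine Finset.mem_image.2 ⟨_, hJ b hb, ?_⟩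
          rw [Equiv.swap_apply_of_ne_of_ne]
          -- Pairs aligned earlier are untouched: equal second entries would make two pairs of the
          -- table coincide, forcing `b = a`.
          · rintro rfl
            have := h'.eq_of_prefix_snd (hJ b hb) hd List.prefix_rfl
            simp [hba] at this
          · simp [hba]

theorem Table.eq_one_of_singleton (hk : 2 ≤ k) {m : Inv k} {d : Word k × Word k}
    (h : Table m {d}) (h₁ : Covers {d.1}) (h₂ : Covers {d.2}) : d.1 = [] ∧ d.2 = [] ∧ m = 1 := by
  have e₁ := eq_nil_of_covers_singleton hk h₁
  have e₂ := eq_nil_of_covers_singleton hk h₂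
  have hm := h.maps d (Finset.mem_singleton_self d)
  rw [e₁, e₂] at hm
  exact ⟨e₁, e₂, inv_ext_of_essential fun x => ⟨[], x, by simpa using hm.append x,
    by simpa using maps_one x⟩⟩

theorem Table.mem_of_covers (hk : 2 ≤ k) {H : Submonoid (Inv k)} (hH : ∀ α β h, swap α β h ∈ H)
    {m : Inv k} {D : Finset (Word k × Word k)} (h : Table m D) (h₁ : Covers (D.image Prod.fst))
    (h₂ : Covers (D.image Prod.snd)) : m ∈ H := by
  induction hn : D.card using Nat.strong_induction_on generalizing m D with
  | _ n ih =>
    subst hn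
    by_cases hs : ∃ d, D = {d}
    · obtain ⟨d, rfl⟩ := hs
      rw [(h.eq_one_of_singleton hk (by simpa using h₁) (by simpa using h₂)).2.2]
      exact one_mem H
    -- The empty word is a prefix of everything, so as an entry it would make the table a singleton.
    have hnil₁ : [] ∉ D.image Prod.fst := by
      intro hmem
      obtain ⟨d, hd, e⟩ := Finset.mem_image.1 hmem
      exact hs ⟨d, Finset.eq_singleton_iff_unique_mem.2 ⟨hd, fun f hf =>
        (h.eq_of_prefix d hd f hf (e ▸ List.nil_prefix)).symm⟩⟩
    have hnil₂ : [] ∉ D.image Prod.snd := by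
      intro hmem
      obtain ⟨d, hd, e⟩ := Finset.mem_image.1 hmem
      exact hs ⟨d, Finset.eq_singleton_iff_unique_mem.2 ⟨hd, fun f hf =>
        (h.eq_of_prefix_snd hd hf (e ▸ List.nil_prefix)).symm⟩⟩
    obtain ⟨u, hu⟩ := h₁.exists_letters (by
      intro p hp q hq hpq
      obtain ⟨d, hd, rfl⟩ := Finset.mem_image.1 hp
      obtain ⟨e, he, rfl⟩ := Finset.mem_image.1 hq
      rw [h.eq_of_prefix d hd e he hpq]) hnil₁
    obtain ⟨v, hv⟩ := h₂.exists_letters (by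
      intro p hp q hq hpq
      obtain ⟨d, hd, rfl⟩ := Finset.mem_image.1 hp
      obtain ⟨e, he, rfl⟩ := Finset.mem_image.1 hq
      rw [h.eq_of_prefix_snd hd he hpq]) hnil₂
    obtain ⟨m', D', hm, h', hc, hD₁, hD₂, hJ⟩ := h.exists_align hH hu hv Finset.univ
    have hD : caret u v ⊆ D' := fun d hd => by
      obtain ⟨a, rfl⟩ := mem_caret.1 hd
      exact hJ a (Finset.mem_univ a)
    obtain ⟨hc₁, hc₂⟩ := Covers.contract_table u v (hD₁ ▸ h₁) (hD₂ ▸ h₂)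
    exact hm (ih _ (hc ▸ card_contract_lt hk hD) (h'.contract (by omega) hD) hc₁ hc₂ rfl)

theorem not_incomp_of_append_eq {p q w v : Word k} (h : p ++ w = q ++ v) : ¬ Incomp q p :=
  fun h' => h'.symm.append_ne w v h

/-- Essentiality of the domain and of the image says exactly that every word can be extended into
them, hence is comparable with an entry of the table. -/
theorem Table.covers_of_mem_G {m : Inv k} (hm : m ∈ G k) {D : Finset (Word k × Word k)}
    (h : Table m D) : Covers (D.image Prod.fst) ∧ Covers (D.image Prod.snd) := by
  obtain ⟨f, hf, h₁, h₂, rfl⟩ := hm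
  rw [isEssential_iff] at h₁ h₂
  constructor
  · intro x
    obtain ⟨w, hw⟩ := h₁ x
    obtain ⟨y, hy⟩ := RIHom.mem_dom.1 hw
    obtain ⟨d, hd, t, v, e⟩ := h.essential _ _ (maps_toInv_of_mem hy)
    rw [List.append_assoc] at e
    exact ⟨d.1, Finset.mem_image_of_mem _ hd, not_incomp_of_append_eq e⟩
  · intro y
    obtain ⟨w, x, hx⟩ := h₂ y
    have hx' : Maps (toInv f hf) x (y ++ w) := maps_toInv_of_mem hx
    obtain ⟨d, hd, t, v, e⟩ := h.essential _ _ hx'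
    have h₃ := hx'.append t
    rw [e] at h₃
    have h₄ := h₃.unique ((h.maps d hd).append v)
    rw [List.append_assoc] at h₄
    exact ⟨d.2, Finset.mem_image_of_mem _ hd, not_incomp_of_append_eq h₄⟩

/-- The Thompson-Higman group is generated by the swaps of words of length at most three. -/
theorem closure_shortSwaps (hk : 2 ≤ k) : Submonoid.closure (shortSwaps k) = G k := by
  refine le_antisymm (Submonoid.closure_le.2 ?_) fun m hm => ?_
  · rintro _ ⟨α, β, h, _, _, rfl⟩
    exact swap_mem_G h
  · obtain ⟨D, hD⟩ := exists_table m
    obtain ⟨h₁, h₂⟩ := hD.covers_of_mem_G hm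
    exact hD.mem_of_covers hk (fun _ _ h => swap_mem_closure_shortSwaps hk h) h₁ h₂

theorem fg_G (hk : 2 ≤ k) : (G k).FG :=
  (Submonoid.fg_iff _).2 ⟨_, closure_shortSwaps hk, finite_shortSwaps k⟩

/-! ### Moving pairs into a free cone -/

/-- The pairs `(u, u)` with `u ∈ U`. -/
def diag (U : Finset (Word k)) : Finset (Word k × Word k) := U.image fun u => (u, u)

theorem mem_diag {U : Finset (Word k)} {d : Word k × Word k} :
    d ∈ diag U ↔ ∃ u ∈ U, (u, u) = d := Finset.mem_image

theorem card_diag (U : Finset (Word k)) : (diag U).card = U.card :=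
  Finset.card_image_of_injective _ fun _ _ h => (Prod.mk.inj h).1

/-- All entries of `D` are incomparable with `x`. -/
def IsFree (D : Finset (Word k × Word k)) (x : Word k) : Prop :=
  ∀ d ∈ D, Incomp d.1 x ∧ Incomp d.2 x

theorem IsFree.append {D : Finset (Word k × Word k)} {x : Word k} (h : IsFree D x) (w : Word k) :
    IsFree D (x ++ w) := fun d hd => ⟨(h d hd).1.append_right w, (h d hd).2.append_right w⟩

/-- Pairs are replaced one at a time by `Table.replace`; each target stays incomparable with the
remaining old pairs and with the diagonal pairs already placed. -/
theorem Table.exists_diag {K : Submonoid (Inv k)} (hK : ∀ α β h, swap α β h ∈ K) {m : Inv k}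
    {D : Finset (Word k × Word k)} (h : Table m D) (U : Finset (Word k))
    (hU : ∀ u ∈ U, ∀ v ∈ U, u ≠ v → Incomp u v) (hD : ∀ u ∈ U, IsFree D u)
    (hc : U.card ≤ D.card) :
    ∃ (m' : Inv k) (D' : Finset (Word k × Word k)), (m' ∈ K → m ∈ K) ∧ D' ⊆ D ∧
      D'.card + U.card = D.card ∧ Table m' (D' ∪ diag U) := by
  induction U using Finset.induction_on with
  | empty => exact ⟨m, D, fun h => h, subset_rfl, rfl, by simpa [diag] using h⟩
  | insert u U hu ih =>
    rw [Finset.card_insert_of_notMem hu] at hc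
    obtain ⟨m', D', hm, hD', hcard, h'⟩ := ih
      (fun v hv w hw => hU v (Finset.mem_insert_of_mem hv) w (Finset.mem_insert_of_mem hw))
      (fun v hv => hD v (Finset.mem_insert_of_mem hv)) (by omega)
    obtain ⟨d, hd⟩ := Finset.card_pos.1 (by omega : 0 < D'.card)
    have hfree : IsFree (D' ∪ diag U) u := by
      intro e he
      rcases Finset.mem_union.1 he with he | he
      · exact hD u (Finset.mem_insert_self _ _) e (hD' he)
      · obtain ⟨v, hv, rfl⟩ := mem_diag.1 he
        have := hU v (Finset.mem_insert_of_mem hv) u (Finset.mem_insert_self _ _)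
          (fun e => hu (e ▸ hv))
        exact ⟨this, this⟩
    have hd' := Finset.mem_union_left (diag U) hd
    have h'' := h'.replace hd' (fun e he => (hfree e he).1) (fun e he => (hfree e he).2)
    refine ⟨_, D'.erase d, fun hmem => hm ?_, (Finset.erase_subset _ _).trans hD', ?_,
      (?_ : Table (swap d.2 u (hfree d hd').2 * m' * swap d.1 u (hfree d hd').1) _)⟩
    · have := mul_mem (mul_mem (hK _ _ (hfree d hd').2) hmem) (hK _ _ (hfree d hd').1)
      simp only [mul_assoc, swap_mul_self, mul_one] at this
      rwa [← mul_assoc, swap_mul_self, one_mul] at this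
    · rw [Finset.card_erase_of_mem hd, Finset.card_insert_of_notMem hu]
      have := Finset.card_pos.2 ⟨d, hd⟩
      omega
    · have hdU : d ∉ diag U := fun hmem => by
        obtain ⟨v, hv, rfl⟩ := mem_diag.1 hmem
        exact (hD v (Finset.mem_insert_of_mem hv) _ (hD' hd)).1.1 List.prefix_rfl
      rw [Finset.erase_union_distrib, Finset.erase_eq_of_notMem hdU, ← Finset.union_insert] at h''
      rwa [diag, Finset.image_insert]

/-! ### Partial identities and tables with a free cone -/

theorem maps_partialId {S : Finset (Word k)} {x y : Word k} (h : Maps (partialId S) x y) :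
    y = x ∧ ∃ s ∈ S, ∃ w v, x ++ w = s ++ v := by
  obtain ⟨w, hw⟩ := exists_mem_of_maps_toInv h
  obtain ⟨⟨s, hs, v, e⟩, e'⟩ := RIHom.mem_idOn.1 hw
  exact ⟨List.append_cancel_right e', s, hs, w, v, e⟩

theorem table_partialId {S : Finset (Word k)} (hS : ∀ u ∈ S, ∀ v ∈ S, u ≠ v → Incomp u v) :
    Table (partialId S) (diag S) := by
  refine ⟨?_, ?_, ?_⟩
  · intro d hd
    obtain ⟨u, hu, rfl⟩ := mem_diag.1 hd
    exact maps_toInv_of_mem (RIHom.mem_idOn.2 ⟨⟨u, hu, [], by simp⟩, rfl⟩)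
  · intro d hd e he hde
    obtain ⟨u, hu, rfl⟩ := mem_diag.1 hd
    obtain ⟨v, hv, rfl⟩ := mem_diag.1 he
    by_cases huv : u = v
    · rw [huv]
    · exact absurd hde (hS u hu v hv huv).1
  · intro x y hxy
    obtain ⟨-, s, hs, w, v, e⟩ := maps_partialId hxy
    exact ⟨(s, s), mem_diag.2 ⟨s, hs, rfl⟩, w, v, e⟩

/-- The swap carries the cone of `c` onto the disjoint cone of `d`, where the second partial
identity is undefined: this is the empty map. -/
theorem table_empty_of_incomp {c d : Word k} (h : Incomp c d) :
    Table (partialId {c} * (swap c d h * partialId {c})) ∅ := by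
  refine ⟨by simp, by simp, fun x z hxz => ?_⟩
  obtain ⟨w, y, h₁, h₂⟩ := hxz.exists_of_mul
  obtain ⟨w', y', h₃, h₄⟩ := h₁.exists_of_mul
  obtain ⟨rfl, s, hs, t, v, e⟩ := maps_partialId h₃
  obtain rfl := Finset.mem_singleton.1 hs
  have h₅ := h₄.append t
  rw [e] at h₅
  have h₆ := h₅.unique ((maps_swap_left h).append v)
  obtain ⟨-, s', hs', t', v', e'⟩ := maps_partialId ((h₂.append w').append t)
  obtain rfl := Finset.mem_singleton.1 hs'
  rw [h₆, List.append_assoc] at e'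
  exact absurd e'.symm (h.append_ne _ _)

/-- The words `u a` for the first `n` letters `a`. -/
def firstChildren (u : Word k) (n : ℕ) : Finset (Word k) :=
  (Finset.univ.filter fun b : Fin k => b.val < n).image fun b => u ++ [b]

theorem card_firstChildren (u : Word k) {n : ℕ} (hn : n ≤ k) : (firstChildren u n).card = n := by
  rw [firstChildren, Finset.card_image_of_injective _ fun a b h => by simpa using h,
    Fin.card_filter_val_lt, min_eq_right hn]

theorem incomp_of_mem_firstChildren {x : Word k} {n : ℕ} :
    ∀ u ∈ firstChildren x n, ∀ v ∈ firstChildren x n, u ≠ v → Incomp u v := by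
  intro u hu v hv huv
  obtain ⟨a, -, rfl⟩ := Finset.mem_image.1 hu
  obtain ⟨b, -, rfl⟩ := Finset.mem_image.1 hv
  exact incomp_of_ne (fun e => huv (by rw [e])) _ _ _

theorem IsFree.firstChildren {D : Finset (Word k × Word k)} {x : Word k} (h : IsFree D x) (n : ℕ) :
    ∀ u ∈ firstChildren x n, IsFree D u := by
  intro u hu
  obtain ⟨a, -, rfl⟩ := Finset.mem_image.1 hu
  exact h.append _

theorem diag_firstChildren (u : Word k) : diag (firstChildren u k) = caret u u := by
  ext d
  simp [mem_diag, mem_caret, ThompsonHigman.firstChildren]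

/-- Induction on the size of the table. With at least `k` pairs, `k` of them are moved onto the
children of `b x a` and contracted. With fewer, all of them are moved below `[a]`, where they form a
given partial identity. -/
theorem mem_of_table_of_isFree (hk : 2 ≤ k) {K : Submonoid (Inv k)}
    (hK : ∀ α β h, swap α β h ∈ K) {a b : Fin k} (hab : a ≠ b)
    (haa : partialId {[a, a]} ∈ K)
    (hS : ∀ n, 1 ≤ n → n < k → partialId (firstChildren [a] n) ∈ K)
    {m : Inv k} {D : Finset (Word k × Word k)} (h : Table m D) {x : Word k}
    (hx : IsFree D (b :: x)) : m ∈ K := by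
  induction hn : D.card using Nat.strong_induction_on generalizing m D x with
  | _ n ih =>
    subst hn
    rcases le_or_gt k D.card with hc | hc
    · obtain ⟨m', D', hm, hD', hD'c, h'⟩ := h.exists_diag hK (firstChildren (b :: x ++ [a]) k)
        incomp_of_mem_firstChildren ((hx.append _).firstChildren k)
        (by rwa [card_firstChildren _ le_rfl])
      have hcard : (D' ∪ diag (firstChildren (b :: x ++ [a]) k)).card ≤ D.card := by
        rw [← hD'c, ← card_diag (firstChildren _ _)]
        exact Finset.card_union_le _ _
      rw [diag_firstChildren] at h' hcard
      refine hm (ih _ ((card_contract_lt hk Finset.subset_union_right).trans_le hcard)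
        -- The contracted pair sits at `b x a`, so the cone of `b x b` is still free for the next
        -- round.
        (h'.contract (by omega) Finset.subset_union_right) (x := x ++ [b]) ?_ rfl)
      intro d hd
      rcases Finset.mem_insert.1 hd with rfl | hd
      · exact ⟨incomp_of_ne hab (b :: x) [] [], incomp_of_ne hab (b :: x) [] []⟩
      · rw [Finset.union_sdiff_right] at hd
        exact hx.append [b] d (hD' (Finset.mem_sdiff.1 hd).1)
    · have hcard : ∀ u : Word k, (firstChildren u D.card).card = D.card := fun u =>
        card_firstChildren u hc.le
      -- The cone of `a` may be occupied, so the pairs are first parked below `b x`; after that it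
      -- is free and can receive them.
      obtain ⟨m₁, D₁, hm₁, -, hc₁, h₁⟩ := h.exists_diag hK (firstChildren (b :: x) D.card)
        incomp_of_mem_firstChildren (hx.firstChildren _) (hcard _).le
      obtain rfl : D₁ = ∅ := Finset.card_eq_zero.1 (by rw [hcard] at hc₁; omega)
      rw [Finset.empty_union] at h₁
      have hfree : IsFree (diag (firstChildren (b :: x) D.card)) [a] := by
        intro d hd
        obtain ⟨u, hu, rfl⟩ := mem_diag.1 hd
        obtain ⟨c, -, rfl⟩ := Finset.mem_image.1 hu
        exact ⟨incomp_of_ne hab.symm [] _ _, incomp_of_ne hab.symm [] _ _⟩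
      obtain ⟨m₂, D₂, hm₂, -, hc₂, h₂⟩ := h₁.exists_diag hK (firstChildren [a] D.card)
        incomp_of_mem_firstChildren (hfree.firstChildren _) (by rw [hcard, card_diag, hcard])
      obtain rfl : D₂ = ∅ := Finset.card_eq_zero.1 (by rw [hcard, card_diag, hcard] at hc₂; omega)
      rw [Finset.empty_union] at h₂
      refine hm₁ (hm₂ ?_)
      -- The empty map is not among the given partial identities and is produced as a product.
      rcases Nat.eq_zero_or_pos D.card with h0 | hpos
      · have hi : Incomp [a, a] [b] := incomp_of_ne hab [] _ _
        have h0' : diag (firstChildren [a] D.card) = ∅ := by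
          rw [← Finset.card_eq_zero, card_diag, hcard, h0]
        rw [h0'] at h₂
        rw [h₂.unique (table_empty_of_incomp hi)]
        exact mul_mem haa (mul_mem (hK _ _ hi) haa)
      · rw [h₂.unique (table_partialId incomp_of_mem_firstChildren)]
        exact hS _ hpos hc

/-! ### Arrows and the conclusion for the inverse monoid -/

theorem maps_arrow (u v w : Word k) : Maps (arrow u v) (u ++ w) (v ++ w) :=
  maps_toInv_of_mem (RIHom.mem_single.2 ⟨w, rfl, rfl⟩)

theorem exists_of_maps_arrow {u v x y : Word k} (h : Maps (arrow u v) x y) :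
    ∃ t w, x ++ t = u ++ w ∧ y ++ t = v ++ w := by
  obtain ⟨t, ht⟩ := exists_mem_of_maps_toInv h
  obtain ⟨w, hw⟩ := RIHom.mem_single.1 ht
  exact ⟨t, w, hw⟩

theorem arrow_mul_arrow (u : Word k) : arrow u [] * arrow [] u = 1 := by
  refine inv_ext_of_essential fun x => ⟨[], x, ?_, by simpa using maps_one x⟩
  simpa using (maps_arrow [] u x).mul (maps_arrow u [] x)

/-- The quantifier over `w` excludes the empty word `x`, whose cone contains `b`; so `x` must begin
with `a`. -/
theorem incomp_of_forall_append {a b : Fin k} (hab : a ≠ b) {x : Word k}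
    (h : ∀ w, ∃ w' v, x ++ w ++ w' = a :: v) : Incomp x [b] := by
  constructor
  · rintro ⟨w, hw⟩
    obtain ⟨w', v, e⟩ := h w
    rw [hw] at e
    exact hab (List.cons.inj e).1.symm
  · rintro ⟨w, rfl⟩
    obtain ⟨w', v, e⟩ := h []
    exact hab (List.cons.inj e).1.symm

theorem Table.isFree_of_arrow {a b : Fin k} (hab : a ≠ b) {m : Inv k}
    {D : Finset (Word k × Word k)} (h : Table (arrow [] [a] * (m * arrow [a] [])) D) :
    IsFree D [b] := by
  intro d hd
  constructor <;> refine incomp_of_forall_append hab fun w => ?_ <;>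
    obtain ⟨w₁, y, h₁, h₂⟩ := ((h.maps d hd).append w).exists_of_mul
  · obtain ⟨w₂, y', h₃, -⟩ := h₁.exists_of_mul
    obtain ⟨t, v, e, -⟩ := exists_of_maps_arrow h₃
    exact ⟨w₁ ++ w₂ ++ t, v, by simpa using e⟩
  · obtain ⟨t, v, -, e⟩ := exists_of_maps_arrow h₂
    exact ⟨w₁ ++ t, v, by simpa using e⟩

theorem firstChildren_one {a : Fin k} (ha : a.val = 0) (u : Word k) :
    firstChildren u 1 = {u ++ [a]} := by
  have : (Finset.univ.filter fun b : Fin k => b.val < 1) = {a} := by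
    ext b
    simp [Fin.ext_iff, ha]
  rw [firstChildren, this, Finset.image_singleton]

/-- The squeezed element has its domain and image inside the cone of `a`, which leaves the cone of
`b` free. The opposite arrows cancel by `arrow_mul_arrow` and give `m` back. -/
theorem eq_top_of_swap_mem (hk : 2 ≤ k) {K : Submonoid (Inv k)} (hK : ∀ α β h, swap α β h ∈ K)
    {a : Fin k} (ha : a.val = 0) (hS : specialElements a ⊆ K) : K = ⊤ := by
  have : Nontrivial (Fin k) := Fin.nontrivial_iff_two_le.2 hk
  obtain ⟨b, hb⟩ := exists_ne a
  have hS' : ∀ n, 1 ≤ n → n < k → partialId (firstChildren [a] n) ∈ K :=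
    fun n h₁ h₂ => hS (Or.inr ⟨n, h₁, h₂, rfl⟩)
  have haa := hS' 1 le_rfl hk
  rw [firstChildren_one ha] at haa
  refine (Submonoid.eq_top_iff' K).2 fun m => ?_
  obtain ⟨D, hD⟩ := exists_table (arrow [] [a] * (m * arrow [a] []))
  have hmem := mem_of_table_of_isFree hk hK hb.symm haa hS' hD (hD.isFree_of_arrow hb.symm)
  have h₁ : arrow [] [a] ∈ K := hS (by simp [specialElements])
  have h₂ : arrow [a] [] ∈ K := hS (by simp [specialElements])
  have := mul_mem (mul_mem h₂ hmem) h₁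
  rwa [← mul_assoc, ← mul_assoc, mul_assoc, arrow_mul_arrow, mul_one, one_mul] at this

theorem finite_specialElements (a : Fin k) : (specialElements a).Finite := by
  refine Set.Finite.union (by simp) ?_
  refine ((Set.finite_lt_nat k).image fun i => partialId
    ((Finset.univ.filter fun b : Fin k => b.val < i).image fun b => [a, b])).subset ?_
  rintro _ ⟨i, _, hi, rfl⟩
  exact ⟨i, hi, rfl⟩

theorem closure_union_specialElements (hk : 2 ≤ k) {a : Fin k} (ha : a.val = 0)
    {T : Set (Inv k)} (hT : Submonoid.closure T = G k) : Submonoid.closure (T ∪ specialElements a) = ⊤ := by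
  refine eq_top_of_swap_mem hk (fun α β h => ?_) ha
    (Set.subset_union_right.trans Submonoid.subset_closure)
  refine Submonoid.closure_mono Set.subset_union_left ?_
  rw [hT]
  exact swap_mem_G h

end ThompsonHigman

theorem theorem3p3 (k : ℕ) (hk : 2 ≤ k) :
    Monoid.FG (ThompsonHigman.Inv k) ∧
    (ThompsonHigman.G k).FG ∧
    ∀ T : Set (ThompsonHigman.Inv k), Submonoid.closure T = ThompsonHigman.G k →
      Submonoid.closure (T ∪ ThompsonHigman.specialElements (⟨0, by omega⟩ : Fin k)) = ⊤ := by
  refine ⟨?_, ThompsonHigman.fg_G hk, fun T hT =>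
    ThompsonHigman.closure_union_specialElements hk rfl hT⟩
  -- The finite generating set is obtained by taking the short swaps for `T`.
  exact Monoid.fg_iff.2 ⟨_, ThompsonHigman.closure_union_specialElements hk
    (a := ⟨0, by omega⟩) rfl (ThompsonHigman.closure_shortSwaps hk),
    (ThompsonHigman.finite_shortSwaps k).union (ThompsonHigman.finite_specialElements _)⟩
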